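/- Let $S$ be a finite set of points in $\mathbb R^d$ in general position: any at most $d+1$ points of $S$ are affinely independent, and no $d+2$ points of $S$ lie on a common sphere. A triangulation of $S$ is a triangulation of the polytope $\operatorname{conv}(S)$ into $d$-simplices meeting face to face, with all vertices in $S$ (not every point of $S$ has to be a vertex). It is called regular if there is a convex function on $\operatorname{conv}(S)$ that is affine on each of its $d$-simplices and is given by different affine functions on different $d$-simplices. The Delaunay triangulation $DT(S)$ is the straight-line dual of the Voronoi diagram of $S$: its $d$-simplices are those spanned by $d+1$ points of $S$ whose Voronoi cells have a common point. The parabolic functional of a triangulation $t$ with $d$-simplices $\Delta_i$ with vertices $x_{i0},\dots,x_{id}$ is $$Vr(t)=\sum_i \left(\|x_{i0}\|^2+\dots+\|x_{id}\|^2\right)\operatorname{vol}(\Delta_i).$$ A flip replaces $t$ by $t'=(t\setminus T_1)\cup T_2$, where $T_1\ne T_2$ are two triangulations of some $d+2$ points of $S$ and every $d$-simplex of $T_1$ belongs to $t$ (triangulations being identified with their sets of $d$-simplices). Theorem 4. For every regular triangulation $t$ of $S$ there is a finite sequence of regular triangulations $t=t_0,t_1,\dots,t_m=DT(S)$ of $S$,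 $m\ge 0$, such that for each $0\le i<m$ the triangulation $t_{i+1}$ is obtained from $t_i$ by a flip and $Vr(t_{i+1})<Vr(t_i)$. -/

import Mathlib

namespace ParabolicFlips

/-- General position of a finite set of points in `ℝᵈ`: any at most `d + 1` of the points are
affinely independent, and no `d + 2` of the points lie on a common sphere. -/
structure GeneralPosition {d : ℕ} (S : Finset (EuclideanSpace ℝ (Fin d))) : Prop where
  affineIndependent : ∀ A ⊆ S, A.card ≤ d + 1 →
    AffineIndependent ℝ (fun x : A => (x : EuclideanSpace ℝ (Fin d)))
  not_cospherical : ∀ A ⊆ S, A.card = d + 2 →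
    ¬ EuclideanGeometry.Cospherical (A : Set (EuclideanSpace ℝ (Fin d)))

/-- `t`, a finite set of `d`-simplices given by their vertex sets, is (the set of maximal cells of)
a triangulation of the point set `S`: a triangulation of the polytope `conv S` all of whose
vertices are in `S`. Not every point of `S` has to be used as a vertex. -/
structure IsTriangulation {d : ℕ} (S : Finset (EuclideanSpace ℝ (Fin d)))
    (t : Finset (Finset (EuclideanSpace ℝ (Fin d)))) : Prop where
  subset : ∀ σ ∈ t, σ ⊆ S
  card_eq : ∀ σ ∈ t, σ.card = d + 1
  affineIndependent : ∀ σ ∈ t,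
    AffineIndependent ℝ (fun x : σ => (x : EuclideanSpace ℝ (Fin d)))
  cover : (⋃ σ ∈ t, convexHull ℝ (σ : Set (EuclideanSpace ℝ (Fin d)))) =
    convexHull ℝ (S : Set (EuclideanSpace ℝ (Fin d)))
  inter : ∀ σ ∈ t, ∀ τ ∈ t,
    convexHull ℝ (σ : Set (EuclideanSpace ℝ (Fin d))) ∩ convexHull ℝ ↑τ =
      convexHull ℝ ((σ : Set (EuclideanSpace ℝ (Fin d))) ∩ ↑τ)

/-- `t` is regular: there is a convex function on `conv S` that is affine on every maximal cell of
`t` and is given by different affine functions on different maximal cells. -/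
def IsRegular {d : ℕ} (S : Finset (EuclideanSpace ℝ (Fin d)))
    (t : Finset (Finset (EuclideanSpace ℝ (Fin d)))) : Prop :=
  ∃ (f : EuclideanSpace ℝ (Fin d) → ℝ)
    (g : Finset (EuclideanSpace ℝ (Fin d)) → (EuclideanSpace ℝ (Fin d) →ᵃ[ℝ] ℝ)),
    ConvexOn ℝ (convexHull ℝ (S : Set (EuclideanSpace ℝ (Fin d)))) f ∧
    (∀ σ ∈ t, Set.EqOn f (g σ) (convexHull ℝ (σ : Set (EuclideanSpace ℝ (Fin d))))) ∧
    Set.InjOn g (t : Set (Finset (EuclideanSpace ℝ (Fin d))))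

/-- A regular triangulation of `S`. -/
def IsRegularTriangulation {d : ℕ} (S : Finset (EuclideanSpace ℝ (Fin d)))
    (t : Finset (Finset (EuclideanSpace ℝ (Fin d)))) : Prop :=
  IsTriangulation S t ∧ IsRegular S t

/-- The Voronoi cell of the site `x` with respect to the set of sites `S`. -/
def voronoiCell {d : ℕ} (S : Finset (EuclideanSpace ℝ (Fin d)))
    (x : EuclideanSpace ℝ (Fin d)) : Set (EuclideanSpace ℝ (Fin d)) :=
  {c | ∀ y ∈ S, dist c x ≤ dist c y}

open Classical in
/-- The maximal cells of the Delaunay triangulation of `S`, the straight-line dual of the Voronoi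
diagram: `d + 1` points of `S` span a cell when their Voronoi cells have a common point (which is
then the centre of a sphere through the `d + 1` points with no point of `S` inside). -/
noncomputable def delaunay {d : ℕ} (S : Finset (EuclideanSpace ℝ (Fin d))) :
    Finset (Finset (EuclideanSpace ℝ (Fin d))) :=
  (S.powersetCard (d + 1)).filter (fun σ => (⋂ x ∈ σ, voronoiCell S x).Nonempty)

/-- The parabolic (Voronoi) functional: the sum over the `d`-simplices of `t` of the volume times
the sum of the squared norms of the vertices. -/
noncomputable def Vr {d : ℕ} (t : Finset (Finset (EuclideanSpace ℝ (Fin d)))) : ℝ :=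
  ∑ σ ∈ t, (∑ x ∈ σ, ‖x‖ ^ 2) *
    MeasureTheory.volume.real (convexHull ℝ (σ : Set (EuclideanSpace ℝ (Fin d))))

/-- `t'` arises from `t` by a flip: some `d + 2` points `Z` of `S` have two different
triangulations `T₁` and `T₂`, the simplices of `T₁` all belong to `t`, and `t'` is obtained from
`t` by substituting `T₂` for `T₁`. -/
def IsFlip {d : ℕ} (S : Finset (EuclideanSpace ℝ (Fin d)))
    (t t' : Finset (Finset (EuclideanSpace ℝ (Fin d)))) : Prop :=
  ∃ (Z : Finset (EuclideanSpace ℝ (Fin d)))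
    (T₁ T₂ : Finset (Finset (EuclideanSpace ℝ (Fin d)))),
    Z ⊆ S ∧ Z.card = d + 2 ∧
    IsTriangulation Z T₁ ∧ IsTriangulation Z T₂ ∧ T₁ ≠ T₂ ∧
    T₁ ⊆ t ∧
    (t' : Set (Finset (EuclideanSpace ℝ (Fin d)))) = ((t : Set _) \ (T₁ : Set _)) ∪ (T₂ : Set _)

end ParabolicFlips

/-!
# Decreasing flips lead from every regular triangulation to the Delaunay triangulation

A height function `h` on `S` lifts the points of `S` by one dimension. The lower facets of the
lifted points project to a set of simplices, `lowerCells S h`. If no `d + 2` lifted points lie on a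
common hyperplane (`IsGeneric`), this is a regular triangulation (`isTriangulation_lowerCells`,
`isRegular_lowerCells`). Conversely every regular triangulation is of this form
(`exists_eq_lowerCells`), and the paraboloid `‖x‖ ^ 2` gives the Delaunay triangulation
(`lowerCells_paraboloid`).

Let `t` be given by heights `w`, and move the heights along `w + u ‖x‖ ^ 2` for `u ≥ 0`. If `t` is
not the Delaunay triangulation, there is a first moment `u` at which some `d + 2` points `Z` become
coplanar in a lower facet. For generic `w` this happens for one set `Z` only
(`exists_generic_heights`), so past that moment only the cells inside `Z` have changed, from one
triangulation of `Z` to the other: this is a flip (`IsCritical.isFlip`).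

The new triangulation of `Z` is the one that is lower on the paraboloid. If `ν` is the affine
dependence of `Z`, the simplex opposite to `y ∈ Z` has volume `|ν y|` times a constant `V`, because
exchanging a vertex is the effect of a transvection (`IsSimplex.volume_exchange`). The two
triangulations of `Z` consist of the simplices opposite to the points where `ν` is positive,
respectively negative. Hence the change of `Vr` is, up to sign,
`V ∑ ν y (Q - ‖y‖ ^ 2) = - V ∑ ν y ‖y‖ ^ 2`, where `Q` is the sum of the squared norms of
the points of `Z`, and it is negative on the side of the paraboloid (`Vr_lowerCells_lt`).
Since `S` has finitely many triangulations and each flip decreases `Vr`, the flips must end, and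
they can only end in the Delaunay triangulation.
-/

namespace ParabolicFlips

variable {d : ℕ}

local notation "E" => EuclideanSpace ℝ (Fin d)

/-! ### Simplices, barycentric coordinates and general position -/

/-- A set of `d + 1` affinely independent points, the vertex set of a `d`-simplex. -/
structure IsSimplex (σ : Finset E) : Prop where
  card_eq : σ.card = d + 1
  affineIndependent : AffineIndependent ℝ (fun x : σ => (x : E))

theorem GeneralPosition.isSimplex {S σ : Finset E} (hS : GeneralPosition S) (hσ : σ ⊆ S)
    (hc : σ.card = d + 1) : IsSimplex σ :=
  ⟨hc, hS.affineIndependent σ hσ hc.le⟩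

theorem IsTriangulation.isSimplex {S σ : Finset E} {t : Finset (Finset E)}
    (ht : IsTriangulation S t) (hσ : σ ∈ t) : IsSimplex σ :=
  ⟨ht.card_eq σ hσ, ht.affineIndependent σ hσ⟩

theorem GeneralPosition.mono {S Z : Finset E} (hS : GeneralPosition S) (hZ : Z ⊆ S) :
    GeneralPosition Z :=
  ⟨fun A hA => hS.affineIndependent A (hA.trans hZ), fun A hA => hS.not_cospherical A (hA.trans hZ)⟩

/-- The vertices of a simplex as an affine basis of the space. -/
noncomputable def IsSimplex.basis {σ : Finset E} (hσ : IsSimplex σ) : AffineBasis σ ℝ E where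
  toFun := fun x => (x : E)
  ind' := hσ.affineIndependent
  tot' := by
    rw [hσ.affineIndependent.affineSpan_eq_top_iff_card_eq_finrank_add_one]
    simp [hσ.card_eq]

@[simp] theorem IsSimplex.basis_apply {σ : Finset E} (hσ : IsSimplex σ) (x : σ) :
    hσ.basis x = x := rfl

theorem IsSimplex.range_basis {σ : Finset E} (hσ : IsSimplex σ) :
    Set.range hσ.basis = (σ : Set E) := by
  ext x; simp

open Classical in
/-- The barycentric coordinate at the vertex `y` with respect to the simplex `σ`, as an affine
function on the whole space. It is `0` when `σ` is not a simplex or `y` is not a vertex of it. -/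
noncomputable def bary (σ : Finset E) (y : E) : E →ᵃ[ℝ] ℝ :=
  if h : IsSimplex σ ∧ y ∈ σ then h.1.basis.coord ⟨y, h.2⟩ else 0

theorem IsSimplex.bary_eq {σ : Finset E} (hσ : IsSimplex σ) (y : σ) :
    bary σ (y : E) = hσ.basis.coord y := by
  rw [bary, dif_pos ⟨hσ, y.2⟩]

theorem IsSimplex.bary_self {σ : Finset E} (hσ : IsSimplex σ) {y : E} (hy : y ∈ σ) :
    bary σ y y = 1 := by
  rw [hσ.bary_eq ⟨y, hy⟩]
  exact hσ.basis.coord_apply_eq ⟨y, hy⟩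

theorem IsSimplex.bary_of_ne {σ : Finset E} (hσ : IsSimplex σ) {y z : E} (hy : y ∈ σ)
    (hz : z ∈ σ) (h : y ≠ z) : bary σ y z = 0 := by
  rw [hσ.bary_eq ⟨y, hy⟩]
  exact hσ.basis.coord_apply_ne (j := ⟨z, hz⟩) (fun e => h (congrArg Subtype.val e))

theorem IsSimplex.sum_bary {σ : Finset E} (hσ : IsSimplex σ) (p : E) :
    ∑ y ∈ σ, bary σ y p = 1 := by
  rw [← hσ.basis.sum_coord_apply_eq_one p, ← Finset.sum_coe_sort]
  exact Finset.sum_congr rfl fun y _ => by rw [hσ.bary_eq]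

theorem IsSimplex.sum_bary_smul {σ : Finset E} (hσ : IsSimplex σ) (p : E) :
    ∑ y ∈ σ, bary σ y p • y = p := by
  rw [← Finset.sum_coe_sort]
  refine Eq.trans ?_ (hσ.basis.linear_combination_coord_eq_self p)
  exact Finset.sum_congr rfl fun y _ => by rw [hσ.bary_eq]; rfl

/-- An affine function commutes with affine combinations. -/
theorem map_sum_smul (g : E →ᵃ[ℝ] ℝ) {s : Finset E} {w : E → ℝ} (hw : ∑ y ∈ s, w y = 1) :
    g (∑ y ∈ s, w y • y) = ∑ y ∈ s, w y * g y := by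
  have h1 : ∀ x, g x = g.linear x + g 0 := fun x => by
    simpa using congrFun g.decomp x
  rw [h1, map_sum]
  simp only [map_smul, smul_eq_mul]
  rw [Finset.sum_congr rfl (fun y _ => by rw [h1 y] :
    ∀ y ∈ s, w y * g y = w y * (g.linear y + g 0))]
  simp only [mul_add, Finset.sum_add_distrib, ← Finset.sum_mul, hw, one_mul]

theorem IsSimplex.apply_eq_sum {σ : Finset E} (hσ : IsSimplex σ) (g : E →ᵃ[ℝ] ℝ) (p : E) :
    g p = ∑ y ∈ σ, bary σ y p * g y := by
  conv_lhs => rw [← hσ.sum_bary_smul p]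
  exact map_sum_smul g (hσ.sum_bary p)

theorem IsSimplex.mem_convexHull_iff {σ : Finset E} (hσ : IsSimplex σ) {p : E} :
    p ∈ convexHull ℝ (σ : Set E) ↔ ∀ y ∈ σ, 0 ≤ bary σ y p := by
  rw [← hσ.range_basis, hσ.basis.convexHull_eq_nonneg_coord]
  constructor
  · intro h y hy
    rw [hσ.bary_eq ⟨y, hy⟩]; exact h ⟨y, hy⟩
  · intro h y
    have := h y y.2
    rwa [hσ.bary_eq] at this

theorem IsSimplex.mem_interior_iff {σ : Finset E} (hσ : IsSimplex σ) {p : E} :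
    p ∈ interior (convexHull ℝ (σ : Set E)) ↔ ∀ y ∈ σ, 0 < bary σ y p := by
  rw [← hσ.range_basis, hσ.basis.interior_convexHull]
  constructor
  · intro h y hy
    rw [hσ.bary_eq ⟨y, hy⟩]; exact h ⟨y, hy⟩
  · intro h y
    have := h y y.2
    rwa [hσ.bary_eq] at this

theorem IsSimplex.interior_nonempty {σ : Finset E} (hσ : IsSimplex σ) :
    (interior (convexHull ℝ (σ : Set E))).Nonempty := by
  rw [← hσ.range_basis]
  exact ⟨_, hσ.basis.centroid_mem_interior_convexHull⟩

theorem IsSimplex.nonempty {σ : Finset E} (hσ : IsSimplex σ) : σ.Nonempty := by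
  rw [← Finset.card_pos, hσ.card_eq]; omega

/-- Affine functions are compared on a convex hull by comparing them at the generating points. -/
theorem le_on_convexHull {s : Set E} {g g' : E →ᵃ[ℝ] ℝ} (h : ∀ x ∈ s, g x ≤ g' x) {p : E}
    (hp : p ∈ convexHull ℝ s) : g p ≤ g' p := by
  have hc : Convex ℝ {x : E | g x ≤ g' x} := by
    have h2 : {x : E | g x ≤ g' x} = (g' - g) ⁻¹' Set.Ici 0 := by
      ext x; simp
    rw [h2]
    exact (convex_Ici 0).affine_preimage _
  exact convexHull_min h hc hp

/-- A nonzero affine function cannot vanish on a nonempty open set. -/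
theorem eq_of_eqOn_open {U : Set E} (hU : IsOpen U) (hne : U.Nonempty) {g g' : E →ᵃ[ℝ] ℝ}
    (h : Set.EqOn g g' U) : g = g' := by
  ext z
  have hz : z ∈ affineSpan ℝ U := by rw [hU.affineSpan_eq_top hne]; trivial
  refine affineSpan_induction (p := fun x => g x = g' x) hz (fun x hx => h hx) ?_
  intro c u v w hu hv hw
  simp only [AffineMap.map_vadd, map_smul, AffineMap.linearMap_vsub, hu, hv, hw]

theorem dense_ne_zero {g : E →ᵃ[ℝ] ℝ} (hg : g ≠ 0) : Dense {p : E | g p ≠ 0} := by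
  have hc : {p : E | g p ≠ 0} = {p : E | g p = 0}ᶜ := rfl
  rw [hc, ← interior_eq_empty_iff_dense_compl]
  by_contra hne
  rw [← Ne, ← Set.nonempty_iff_ne_empty] at hne
  refine hg (eq_of_eqOn_open isOpen_interior hne fun x hx => ?_)
  simpa using interior_subset hx

/-- The affine function with the values of `h` at the vertices of `σ`. -/
noncomputable def interp (σ : Finset E) (h : E → ℝ) : E →ᵃ[ℝ] ℝ := ∑ y ∈ σ, h y • bary σ y

theorem interp_apply (σ : Finset E) (h : E → ℝ) (p : E) :
    interp σ h p = ∑ y ∈ σ, h y * bary σ y p := by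
  have : ∀ s : Finset E, (∑ y ∈ s, h y • bary σ y : E →ᵃ[ℝ] ℝ) p = ∑ y ∈ s, h y * bary σ y p := by
    classical
    intro s
    induction s using Finset.induction_on with
    | empty => simp
    | insert a s ha ih => rw [Finset.sum_insert ha, Finset.sum_insert ha, ← ih]; simp
  exact this σ

theorem IsSimplex.eq_interp {σ : Finset E} (hσ : IsSimplex σ) {g : E →ᵃ[ℝ] ℝ} {h : E → ℝ}
    (hg : ∀ x ∈ σ, g x = h x) : g = interp σ h := by
  ext p
  rw [interp_apply, hσ.apply_eq_sum g p]
  exact Finset.sum_congr rfl fun y hy => by rw [hg y hy, mul_comm]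

theorem IsSimplex.interp_of_mem {σ : Finset E} (hσ : IsSimplex σ) (h : E → ℝ) {x : E}
    (hx : x ∈ σ) : interp σ h x = h x := by
  rw [interp_apply, Finset.sum_eq_single x, hσ.bary_self hx, mul_one]
  · intro y hy hyx; rw [hσ.bary_of_ne hy hx hyx, mul_zero]
  · exact fun h => absurd hx h

/-- The height of the lifted point `(x, h x)` over the hyperplane through the lifted vertices
of `σ`. -/
noncomputable def gap (σ : Finset E) (x : E) (h : E → ℝ) : ℝ := h x - interp σ h x

theorem gap_add (σ : Finset E) (x : E) (h k : E → ℝ) :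
    gap σ x (h + k) = gap σ x h + gap σ x k := by
  simp only [gap, interp_apply, Pi.add_apply, add_mul, Finset.sum_add_distrib]; ring

theorem gap_smul (σ : Finset E) (x : E) (c : ℝ) (h : E → ℝ) :
    gap σ x (c • h) = c * gap σ x h := by
  simp only [gap, interp_apply, Pi.smul_apply, smul_eq_mul, mul_assoc, ← Finset.mul_sum]; ring

theorem gap_add_smul (σ : Finset E) (x : E) (h k : E → ℝ) (c : ℝ) :
    gap σ x (h + c • k) = gap σ x h + c * gap σ x k := by
  rw [gap_add, gap_smul]

theorem IsSimplex.gap_eq_sub {σ : Finset E} (hσ : IsSimplex σ) {g : E →ᵃ[ℝ] ℝ} {h : E → ℝ}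
    (hg : ∀ x ∈ σ, g x = h x) (x : E) : gap σ x h = h x - g x := by
  rw [gap, hσ.eq_interp hg]

/-- In general position no barycentric coordinate of a further point vanishes. -/
theorem GeneralPosition.bary_ne_zero {S σ : Finset E} (hS : GeneralPosition S) (hσS : σ ⊆ S)
    (hσ : IsSimplex σ) {x y : E} (hx : x ∈ S) (hxσ : x ∉ σ) (hy : y ∈ σ) : bary σ y x ≠ 0 := by
  classical
  intro h0
  set A : Finset E := insert x (σ.erase y) with hA
  have hxe : x ∉ σ.erase y := fun h => hxσ (Finset.mem_of_mem_erase h)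
  have hAc : A.card = d + 1 := by
    rw [hA, Finset.card_insert_of_notMem hxe, Finset.card_erase_of_mem hy, hσ.card_eq]; rfl
  have hAS : A ⊆ S := Finset.insert_subset hx ((Finset.erase_subset _ _).trans hσS)
  have hAs : IsSimplex A := hS.isSimplex hAS hAc
  -- `bary A x` is `1` at `x`, but vanishes at the vertices that carry `x` as a combination
  have h1 := hAs.bary_self (Finset.mem_insert_self x _)
  rw [hσ.apply_eq_sum (bary A x) x, Finset.sum_eq_zero] at h1
  · exact zero_ne_one h1
  · intro z hz
    by_cases hzy : z = y
    · rw [hzy, h0, zero_mul]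
    · have hz' : z ∈ σ.erase y := Finset.mem_erase.2 ⟨hzy, hz⟩
      rw [hAs.bary_of_ne (Finset.mem_insert_self x _) (Finset.mem_insert_of_mem hz')
        (fun e => hxe (e ▸ hz')), mul_zero]

/-- In general position every open set contains a point off all hyperplanes spanned by facets of
simplices with vertices in `S`. -/
theorem exists_generic_point (S : Finset E) {U : Set E} (hU : IsOpen U) (hne : U.Nonempty) :
    ∃ p ∈ U, ∀ σ ⊆ S, IsSimplex σ → ∀ y ∈ σ, bary σ y p ≠ 0 := by
  classical
  let I : Finset (Finset E × E) := (S.powerset ×ˢ S).filter (fun a => IsSimplex a.1 ∧ a.2 ∈ a.1)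
  have hd : Dense (⋂ a ∈ (I : Set (Finset E × E)), {p : E | bary a.1 a.2 p ≠ 0}) := by
    refine dense_biInter_of_isOpen (fun a _ => ?_) I.countable_toSet (fun a ha => ?_)
    · exact isOpen_ne_fun (bary a.1 a.2).continuous_of_finiteDimensional continuous_const
    · apply dense_ne_zero
      intro h0
      have h2 := (Finset.mem_filter.1 ha).2
      have := h2.1.bary_self h2.2
      rw [h0] at this
      simp at this
  obtain ⟨p, hpU, hp⟩ := hd.inter_open_nonempty U hU hne
  refine ⟨p, hpU, fun σ hσS hσ y hy => ?_⟩
  have := Set.mem_iInter₂.1 hp (σ, y) (by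
    simp only [I, Finset.coe_filter, Finset.mem_product, Finset.mem_powerset, Set.mem_ofPred_eq]
    exact ⟨⟨hσS, hσS hy⟩, hσ, hy⟩)
  exact this

/-- The square of the norm, the height function that lifts points to the paraboloid. -/
noncomputable def paraboloid : E → ℝ := fun x => ‖x‖ ^ 2

theorem dist_sq_eq (x c : E) : dist x c ^ 2 = paraboloid x - 2 * inner ℝ c x + ‖c‖ ^ 2 := by
  rw [dist_eq_norm, norm_sub_sq_real, paraboloid, real_inner_comm]

/-- Every affine function is `x ↦ 2 ⟪c, x⟫ + b` for some `c` and `b`; it is thus the difference of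
the paraboloid and a squared distance, up to a constant. -/
theorem exists_eq_inner (g : E →ᵃ[ℝ] ℝ) : ∃ (c : E) (b : ℝ), ∀ x, g x = 2 * inner ℝ c x + b := by
  let ℓ : E →L[ℝ] ℝ := LinearMap.toContinuousLinearMap g.linear
  refine ⟨(1 / 2 : ℝ) • (InnerProductSpace.toDual ℝ E).symm ℓ, g 0, fun x => ?_⟩
  rw [real_inner_smul_left, InnerProductSpace.toDual_symm_apply]
  have := congrFun g.decomp x
  simp only [Pi.add_apply] at this
  rw [this]
  simp only [ℓ, LinearMap.coe_toContinuousLinearMap']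
  ring

/-- A further point of `S` is never on the hyperplane through a lifted simplex of the paraboloid:
the `d + 2` points would lie on a common sphere. -/
theorem GeneralPosition.gap_paraboloid_ne_zero {S σ : Finset E} (hS : GeneralPosition S)
    (hσS : σ ⊆ S) (hσ : IsSimplex σ) {x : E} (hx : x ∈ S) (hxσ : x ∉ σ) :
    gap σ x paraboloid ≠ 0 := by
  classical
  intro h0
  obtain ⟨c, b, hcb⟩ := exists_eq_inner (interp σ paraboloid)
  refine hS.not_cospherical (insert x σ) (Finset.insert_subset hx hσS)
    (by rw [Finset.card_insert_of_notMem hxσ, hσ.card_eq]) ⟨c, √(b + ‖c‖ ^ 2), fun p hp => ?_⟩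
  have hp' : paraboloid p = 2 * inner ℝ c p + b := by
    rw [← hcb]
    rcases Finset.mem_insert.1 (Finset.mem_coe.1 hp) with rfl | hp
    · rw [gap] at h0; linarith
    · exact (hσ.interp_of_mem _ hp).symm
  have h2 := dist_sq_eq p c
  rw [hp'] at h2
  rw [← Real.sqrt_sq (dist_nonneg (x := p) (y := c)), h2]
  congr 1; ring

/-! ### Lower cells of lifted points -/

open Classical in
/-- The lower facets of the points of `S` lifted to the heights `h`, projected back: the simplices
with vertices in `S` such that all other points of `S` are lifted strictly above the hyperplane
through the lifted vertices. -/
noncomputable def lowerCells (S : Finset E) (h : E → ℝ) : Finset (Finset E) :=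
  (S.powersetCard (d + 1)).filter (fun σ => ∀ x ∈ S, x ∉ σ → 0 < gap σ x h)

theorem mem_lowerCells {S σ : Finset E} {h : E → ℝ} :
    σ ∈ lowerCells S h ↔ σ ⊆ S ∧ σ.card = d + 1 ∧ ∀ x ∈ S, x ∉ σ → 0 < gap σ x h := by
  rw [lowerCells, Finset.mem_filter, Finset.mem_powersetCard, and_assoc]

/-- No `d + 2` points of `S`, lifted to the heights `h`, lie on a common hyperplane. -/
def IsGeneric (S : Finset E) (h : E → ℝ) : Prop :=
  ∀ σ ⊆ S, IsSimplex σ → ∀ x ∈ S, x ∉ σ → gap σ x h ≠ 0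

theorem GeneralPosition.isSimplex_of_mem_lowerCells {S σ : Finset E} {h : E → ℝ}
    (hS : GeneralPosition S) (hσ : σ ∈ lowerCells S h) : IsSimplex σ :=
  hS.isSimplex (mem_lowerCells.1 hσ).1 (mem_lowerCells.1 hσ).2.1

theorem interp_le_of_mem_lowerCells {S σ : Finset E} {h : E → ℝ}
    (hS : GeneralPosition S) (hσ : σ ∈ lowerCells S h) {x : E} (hx : x ∈ S) :
    interp σ h x ≤ h x := by
  by_cases hxσ : x ∈ σ
  · exact ((hS.isSimplex_of_mem_lowerCells hσ).interp_of_mem h hxσ).le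
  · have := (mem_lowerCells.1 hσ).2.2 x hx hxσ
    rw [gap] at this; linarith

theorem interp_le_interp {S σ τ : Finset E} {h : E → ℝ}
    (hS : GeneralPosition S) (hσ : σ ∈ lowerCells S h) (hτ : τ ∈ lowerCells S h) {p : E}
    (hp : p ∈ convexHull ℝ (τ : Set E)) : interp σ h p ≤ interp τ h p := by
  refine le_on_convexHull (fun x hx => ?_) hp
  rw [(hS.isSimplex_of_mem_lowerCells hτ).interp_of_mem h hx]
  exact interp_le_of_mem_lowerCells hS hσ ((mem_lowerCells.1 hτ).1 hx)

/-- Lower cells meet face to face: over a common point the two affine functions agree, so only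
vertices at which they agree, the common ones, have nonzero coordinates. -/
theorem lowerCells_inter {S σ τ : Finset E} {h : E → ℝ}
    (hS : GeneralPosition S) (hσ : σ ∈ lowerCells S h) (hτ : τ ∈ lowerCells S h) :
    convexHull ℝ (σ : Set E) ∩ convexHull ℝ ↑τ = convexHull ℝ ((σ : Set E) ∩ ↑τ) := by
  classical
  refine subset_antisymm ?_ (Set.subset_inter (convexHull_mono Set.inter_subset_left)
    (convexHull_mono Set.inter_subset_right))
  rintro p ⟨hpσ, hpτ⟩
  have hs := hS.isSimplex_of_mem_lowerCells hτ
  have heq : interp σ h p = interp τ h p :=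
    le_antisymm (interp_le_interp hS hσ hτ hpτ) (interp_le_interp hS hτ hσ hpσ)
  have hnn := hs.mem_convexHull_iff.1 hpτ
  have hsum : ∑ y ∈ τ, bary τ y p * (interp τ h y - interp σ h y) = 0 := by
    simp only [mul_sub, Finset.sum_sub_distrib]
    rw [← hs.apply_eq_sum, ← hs.apply_eq_sum, heq, sub_self]
  have hle : ∀ y ∈ τ, 0 ≤ interp τ h y - interp σ h y := fun y hy =>
    sub_nonneg.2 (interp_le_interp hS hσ hτ (subset_convexHull ℝ _ hy))
  rw [Finset.sum_eq_zero_iff_of_nonneg fun y hy => mul_nonneg (hnn y hy) (hle y hy)] at hsum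
  have hzero : ∀ y ∈ τ, y ∉ τ ∩ σ → bary τ y p = 0 := fun y hy hyσ => by
    have hyσ' : y ∉ σ := fun h => hyσ (Finset.mem_inter.2 ⟨hy, h⟩)
    have h1 := (mem_lowerCells.1 hσ).2.2 y ((mem_lowerCells.1 hτ).1 hy) hyσ'
    rw [gap, ← hs.interp_of_mem h hy] at h1
    exact (mul_eq_zero.1 (hsum y hy)).resolve_right h1.ne'
  rw [Set.inter_comm, ← Finset.coe_inter, Finset.mem_convexHull']
  refine ⟨fun y => bary τ y p, fun y hy => hnn y (Finset.mem_inter.1 hy).1, ?_, ?_⟩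
  · rw [← hs.sum_bary p]
    exact Finset.sum_subset Finset.inter_subset_left hzero
  · refine Eq.trans ?_ (hs.sum_bary_smul p)
    exact Finset.sum_subset Finset.inter_subset_left fun y hy hy' => by
      simp only [hzero y hy hy', zero_smul]

/-- A point of a simplex stays covered when a suitable vertex is exchanged for a given point. -/
theorem IsSimplex.exists_exchange [DecidableEq E] {σ : Finset E} (hσ : IsSimplex σ) {x p : E}
    (hx : x ∉ σ) (hp : p ∈ convexHull ℝ (σ : Set E)) :
    ∃ y ∈ σ, p ∈ convexHull ℝ (insert x (σ.erase y) : Finset E) := by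
  have hnn := hσ.mem_convexHull_iff.1 hp
  have hne : (σ.filter (fun y => 0 < bary σ y x)).Nonempty := by
    rw [Finset.filter_nonempty_iff]
    by_contra! hcon
    have := Finset.sum_nonpos hcon
    rw [hσ.sum_bary] at this
    linarith
  obtain ⟨y, hy, hmin⟩ := Finset.exists_min_image _ (fun y => bary σ y p / bary σ y x) hne
  obtain ⟨hyσ, hypos⟩ := Finset.mem_filter.1 hy
  set ε := bary σ y p / bary σ y x with hε
  have hε0 : 0 ≤ ε := div_nonneg (hnn y hyσ) hypos.le
  refine ⟨y, hyσ, ?_⟩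
  have hxe : x ∉ σ.erase y := fun h => hx (Finset.mem_of_mem_erase h)
  have hy0 : bary σ y p - ε * bary σ y x = 0 := by
    rw [hε, div_mul_cancel₀ _ hypos.ne', sub_self]
  rw [Finset.mem_convexHull']
  have hne' : ∀ z ∈ σ.erase y, z ≠ x := fun z hz e => hxe (e ▸ hz)
  refine ⟨fun z => if z = x then ε else bary σ z p - ε * bary σ z x, ?_, ?_, ?_⟩
  · intro z hz
    rcases Finset.mem_insert.1 hz with rfl | hz
    · simpa using hε0
    · simp only [hne' z hz, if_false]
      have hzσ := Finset.mem_of_mem_erase hz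
      rcases le_or_gt (bary σ z x) 0 with h0 | h0
      · have := mul_nonneg hε0 (neg_nonneg.2 h0)
        have := hnn z hzσ
        linarith
      · have := hmin z (Finset.mem_filter.2 ⟨hzσ, h0⟩)
        rw [le_div_iff₀ h0] at this
        linarith
  · rw [Finset.sum_insert hxe, if_pos rfl,
      Finset.sum_congr rfl fun z hz => if_neg (hne' z hz)]
    have := Finset.add_sum_erase σ (fun z => bary σ z p - ε * bary σ z x) hyσ
    rw [hy0, zero_add] at this
    rw [this, Finset.sum_sub_distrib, ← Finset.mul_sum, hσ.sum_bary, hσ.sum_bary]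
    ring
  · rw [Finset.sum_insert hxe, Finset.sum_congr rfl fun z hz => by
      beta_reduce; rw [if_neg (hne' z hz)]]
    beta_reduce
    rw [if_pos rfl]
    have := Finset.add_sum_erase σ (fun z => (bary σ z p - ε * bary σ z x) • z) hyσ
    rw [hy0, zero_smul, zero_add] at this
    rw [this]
    simp only [sub_smul, mul_smul, Finset.sum_sub_distrib, ← Finset.smul_sum]
    rw [hσ.sum_bary_smul, hσ.sum_bary_smul]
    abel

theorem GeneralPosition.exists_simplex_mem {S : Finset E} (hS : GeneralPosition S)
    (hc : d + 1 ≤ S.card) {p : E} (hp : p ∈ convexHull ℝ (S : Set E)) :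
    ∃ σ ⊆ S, IsSimplex σ ∧ p ∈ convexHull ℝ (σ : Set E) := by
  rw [convexHull_eq_union] at hp
  simp only [Set.mem_iUnion] at hp
  obtain ⟨A, hAS, hA, hpA⟩ := hp
  have hAc : A.card ≤ d + 1 := by
    have h1 := hA.card_le_finrank_succ
    have h2 := Submodule.finrank_le (vectorSpan ℝ (Set.range ((↑) : A → E)))
    simp only [Fintype.card_coe, finrank_euclideanSpace, Fintype.card_fin] at h1 h2
    omega
  obtain ⟨σ, hAσ, hσS, hσ⟩ := Finset.exists_subsuperset_card_eq (Finset.coe_subset.1 hAS) hAc hc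
  exact ⟨σ, hσS, hS.isSimplex hσS hσ, convexHull_mono (Finset.coe_subset.2 hAσ) hpA⟩

/-- Among the simplices that contain a point off all facets, one whose lift is lowest over that
point is a lower cell: otherwise exchanging a vertex for a point below its hyperplane would give a
lower one. -/
theorem exists_mem_lowerCells {S : Finset E} (hS : GeneralPosition S)
    (hc : d + 1 ≤ S.card) {h : E → ℝ} (hh : IsGeneric S h) {p : E}
    (hp : p ∈ convexHull ℝ (S : Set E))
    (hgen : ∀ σ ⊆ S, IsSimplex σ → ∀ y ∈ σ, bary σ y p ≠ 0) :
    ∃ σ ∈ lowerCells S h, p ∈ convexHull ℝ (σ : Set E) := by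
  classical
  let F := S.powerset.filter (fun σ => IsSimplex σ ∧ p ∈ convexHull ℝ (σ : Set E))
  have hF : ∀ {σ}, σ ∈ F ↔ σ ⊆ S ∧ IsSimplex σ ∧ p ∈ convexHull ℝ (σ : Set E) := by
    intro σ; simp [F]
  obtain ⟨σ₀, h0⟩ := hS.exists_simplex_mem hc hp
  obtain ⟨σ, hσF, hmin⟩ := F.exists_min_image (fun σ => interp σ h p) ⟨σ₀, hF.2 h0⟩
  obtain ⟨hσS, hσ, hpσ⟩ := hF.1 hσF
  refine ⟨σ, mem_lowerCells.2 ⟨hσS, hσ.card_eq, fun x hx hxσ => ?_⟩, hpσ⟩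
  by_contra hcon
  have hneg : gap σ x h < 0 := lt_of_le_of_ne (not_lt.1 hcon) (hh σ hσS hσ x hx hxσ)
  obtain ⟨y, hy, hpA⟩ := hσ.exists_exchange hxσ hpσ
  set A : Finset E := insert x (σ.erase y) with hA
  have hxe : x ∉ σ.erase y := fun h => hxσ (Finset.mem_of_mem_erase h)
  have hAS : A ⊆ S := Finset.insert_subset hx ((Finset.erase_subset _ _).trans hσS)
  have hAs : IsSimplex A := hS.isSimplex hAS (by
    rw [hA, Finset.card_insert_of_notMem hxe, Finset.card_erase_of_mem hy, hσ.card_eq]; rfl)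
  have hle := hmin A (hF.2 ⟨hAS, hAs, hpA⟩)
  have hxA : x ∈ A := Finset.mem_insert_self _ _
  have hpos : 0 < bary A x p :=
    lt_of_le_of_ne (hAs.mem_convexHull_iff.1 hpA x hxA) (hgen A hAS hAs x hxA).symm
  -- the two affine functions agree on the common facet, hence differ by a multiple of `bary A x`
  have hdiff : interp A h p - interp σ h p = bary A x p * gap σ x h := by
    rw [hAs.apply_eq_sum (interp A h) p, hAs.apply_eq_sum (interp σ h) p,
      ← Finset.sum_sub_distrib, Finset.sum_eq_single x]
    · rw [hAs.interp_of_mem h hxA, gap]; ring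
    · intro z hz hzx
      have hzσ := Finset.mem_of_mem_erase (Finset.mem_of_mem_insert_of_ne hz hzx)
      rw [hAs.interp_of_mem h hz, hσ.interp_of_mem h hzσ, sub_self]
    · exact fun h => absurd hxA h
  have := mul_neg_of_pos_of_neg hpos hneg
  linarith

theorem isClosed_convexHull_finset (σ : Finset E) : IsClosed (convexHull ℝ (σ : Set E)) :=
  (Set.Finite.isCompact_convexHull ℝ σ.finite_toSet).isClosed

theorem convexHull_subset_closure_interior {S σ : Finset E} (hσS : σ ⊆ S) (hσ : IsSimplex σ) :
    convexHull ℝ (S : Set E) ⊆ closure (interior (convexHull ℝ (S : Set E))) := by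
  rw [(convex_convexHull ℝ _).closure_interior_eq_closure_of_nonempty_interior
    (hσ.interior_nonempty.mono (interior_mono (convexHull_mono (Finset.coe_subset.2 hσS))))]
  exact subset_closure

theorem lowerCells_cover {S : Finset E} (hS : GeneralPosition S)
    (hc : d + 1 ≤ S.card) {h : E → ℝ} (hh : IsGeneric S h) :
    (⋃ σ ∈ lowerCells S h, convexHull ℝ (σ : Set E)) = convexHull ℝ (S : Set E) := by
  classical
  refine subset_antisymm (Set.iUnion₂_subset fun σ hσ =>
    convexHull_mono (Finset.coe_subset.2 (mem_lowerCells.1 hσ).1)) ?_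
  have hcl : IsClosed (⋃ σ ∈ lowerCells S h, convexHull ℝ (σ : Set E)) :=
    (lowerCells S h).finite_toSet.isClosed_biUnion fun σ _ => isClosed_convexHull_finset σ
  obtain ⟨σ, hσS, hσ⟩ := Finset.exists_subset_card_eq hc
  refine (convexHull_subset_closure_interior hσS (hS.isSimplex hσS hσ)).trans
    (closure_minimal ?_ hcl)
  by_contra hcon
  obtain ⟨q, hq, hq'⟩ := Set.not_subset.1 hcon
  obtain ⟨p, ⟨hp, hp'⟩, hgen⟩ := exists_generic_point S
    (isOpen_interior.inter hcl.isOpen_compl) ⟨q, hq, hq'⟩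
  obtain ⟨τ, hτ, hpτ⟩ := exists_mem_lowerCells hS hc hh (interior_subset hp) hgen
  exact hp' (Set.mem_iUnion₂.2 ⟨τ, hτ, hpτ⟩)

theorem isTriangulation_lowerCells {S : Finset E} (hS : GeneralPosition S)
    (hc : d + 1 ≤ S.card) {h : E → ℝ} (hh : IsGeneric S h) :
    IsTriangulation S (lowerCells S h) where
  subset _ hσ := (mem_lowerCells.1 hσ).1
  card_eq _ hσ := (mem_lowerCells.1 hσ).2.1
  affineIndependent _ hσ := (hS.isSimplex_of_mem_lowerCells hσ).affineIndependent
  cover := lowerCells_cover hS hc hh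
  inter _ hσ _ hτ := lowerCells_inter hS hσ hτ

/-- The upper envelope of the affine functions of the lower cells witnesses regularity. -/
theorem isRegular_lowerCells {S : Finset E} (hS : GeneralPosition S) (h : E → ℝ) :
    IsRegular S (lowerCells S h) := by
  rcases (lowerCells S h).eq_empty_or_nonempty with he | hne
  · exact ⟨fun _ => 0, fun _ => 0, convexOn_const _ (convex_convexHull ℝ _), by simp [he],
      by simp [he]⟩
  refine ⟨fun x => (lowerCells S h).sup' hne fun σ => interp σ h x, fun σ => interp σ h,
    ⟨convex_convexHull ℝ _, ?_⟩, ?_, ?_⟩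
  · intro x _ y _ a b ha hb hab
    refine Finset.sup'_le _ _ fun σ hσ => ?_
    rw [Convex.combo_affine_apply hab]
    simp only [smul_eq_mul]
    gcongr
    · exact Finset.le_sup' (fun σ => interp σ h x) hσ
    · exact Finset.le_sup' (fun σ => interp σ h y) hσ
  · intro σ hσ p hp
    exact le_antisymm (Finset.sup'_le _ _ fun τ hτ => interp_le_interp hS hτ hσ hp)
      (Finset.le_sup' (fun σ => interp σ h p) hσ)
  · intro σ hσ τ hτ heq
    have hs := hS.isSimplex_of_mem_lowerCells hτ
    refine (Finset.eq_of_subset_of_card_le (fun x hx => ?_)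
      (by rw [(mem_lowerCells.1 hσ).2.1, hs.card_eq])).symm
    by_contra hxσ
    have := (mem_lowerCells.1 hσ).2.2 x ((mem_lowerCells.1 hτ).1 hx) hxσ
    have heq' : interp σ h = interp τ h := heq
    rw [gap, heq', hs.interp_of_mem h hx, sub_self] at this
    exact lt_irrefl _ this

/-- A triangulation is not a proper subset of the set of lower cells, since the latter intersect
face to face. -/
theorem eq_lowerCells_of_subset {S : Finset E} (hS : GeneralPosition S) {t : Finset (Finset E)}
    (ht : IsTriangulation S t) {h : E → ℝ} (hsub : t ⊆ lowerCells S h) :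
    t = lowerCells S h := by
  refine subset_antisymm hsub fun σ hσ => ?_
  have hs := hS.isSimplex_of_mem_lowerCells hσ
  obtain ⟨p, hp⟩ := hs.interior_nonempty
  have hpS : p ∈ convexHull ℝ (S : Set E) :=
    convexHull_mono (Finset.coe_subset.2 (mem_lowerCells.1 hσ).1) (interior_subset hp)
  rw [← ht.cover] at hpS
  obtain ⟨τ, hτ, hpτ⟩ := Set.mem_iUnion₂.1 hpS
  have hpi : p ∈ convexHull ℝ ((σ : Set E) ∩ ↑τ) := by
    rw [← lowerCells_inter hS hσ (hsub hτ)]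
    exact ⟨interior_subset hp, hpτ⟩
  have hστ : σ ⊆ τ := by
    intro y hy
    by_contra hyτ
    have h1 := hs.mem_interior_iff.1 hp y hy
    -- `bary σ y` vanishes on the face `σ ∩ τ`
    have h2 : bary σ y p ≤ (0 : E →ᵃ[ℝ] ℝ) p := by
      refine le_on_convexHull (fun z hz => ?_) hpi
      rw [hs.bary_of_ne hy hz.1 (fun e => hyτ (e ▸ hz.2))]
      simp
    exact absurd h1 (not_lt.2 h2)
  rwa [Finset.eq_of_subset_of_card_le hστ (by rw [hs.card_eq, ht.card_eq τ hτ])]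

/-- The lower facets of the points lifted to the paraboloid give the Delaunay triangulation. -/
theorem lowerCells_paraboloid {S : Finset E} (hS : GeneralPosition S) :
    lowerCells S paraboloid = delaunay S := by
  classical
  ext σ
  rw [delaunay, Finset.mem_filter, Finset.mem_powersetCard, mem_lowerCells, and_assoc]
  refine and_congr_right fun hσS => and_congr_right fun hσc => ?_
  have hσ := hS.isSimplex hσS hσc
  constructor
  · intro H
    obtain ⟨c, b, hcb⟩ := exists_eq_inner (interp σ paraboloid)
    have hdist : ∀ x, dist c x ^ 2 = (paraboloid x - interp σ paraboloid x) + (b + ‖c‖ ^ 2) := by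
      intro x; rw [dist_comm, dist_sq_eq, hcb]; ring
    refine ⟨c, Set.mem_iInter₂.2 fun x hx y hy => ?_⟩
    refine le_of_sq_le_sq ?_ dist_nonneg
    rw [hdist, hdist, hσ.interp_of_mem _ hx, sub_self]
    by_cases hyσ : y ∈ σ
    · rw [hσ.interp_of_mem _ hyσ, sub_self]
    · have := H y hy hyσ
      rw [gap] at this
      linarith
  · rintro ⟨c, hc⟩ x hx hxσ
    refine lt_of_le_of_ne ?_ (hS.gap_paraboloid_ne_zero hσS hσ hx hxσ).symm
    obtain ⟨x₀, hx₀⟩ := hσ.nonempty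
    have hle : ∀ y ∈ σ, ∀ z ∈ S, dist c y ≤ dist c z := fun y hy z hz =>
      Set.mem_iInter₂.1 hc y hy z hz
    -- the affine function `|x|² - (|x - c|² - r²)`, where `r` is the circumradius
    let g : E →ᵃ[ℝ] ℝ := (2 • (innerSL ℝ c : E →ₗ[ℝ] ℝ)).toAffineMap +
      AffineMap.const ℝ E (dist c x₀ ^ 2 - ‖c‖ ^ 2)
    have hg : ∀ y, g y = paraboloid y - dist c y ^ 2 + dist c x₀ ^ 2 := by
      intro y
      rw [dist_comm c y, dist_sq_eq]
      simp [g]; ring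
    rw [hσ.gap_eq_sub (g := g), hg]
    · have := pow_le_pow_left₀ dist_nonneg (hle x₀ hx₀ x hx) 2
      linarith
    · intro y hy
      rw [hg, le_antisymm (hle y hy x₀ (hσS hx₀)) (hle x₀ hx₀ y (hσS hy))]
      ring

/-! ### Regular triangulations come from heights -/

/-- The affine function of a simplex on which a convex function is affine supports that function
from below. -/
theorem IsSimplex.le_of_convexOn {S σ : Finset E} (hσ : IsSimplex σ) (hσS : σ ⊆ S) {f : E → ℝ}
    (hf : ConvexOn ℝ (convexHull ℝ (S : Set E)) f) {g : E →ᵃ[ℝ] ℝ}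
    (hg : Set.EqOn f g (convexHull ℝ (σ : Set E))) {x : E}
    (hx : x ∈ convexHull ℝ (S : Set E)) : g x ≤ f x := by
  obtain ⟨c, hc⟩ := hσ.interior_nonempty
  have hcS : c ∈ convexHull ℝ (S : Set E) :=
    convexHull_mono (Finset.coe_subset.2 hσS) (interior_subset hc)
  have hcont : Filter.Tendsto (fun ε : ℝ => (1 - ε) • c + ε • x) (nhdsWithin 0 (Set.Ioi 0))
      (nhds c) := by
    have : Continuous fun ε : ℝ => (1 - ε) • c + ε • x := by fun_prop
    have h0 := this.tendsto 0
    simp only [sub_zero, one_smul, zero_smul, add_zero] at h0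
    exact h0.mono_left nhdsWithin_le_nhds
  have h1 : ∀ᶠ ε : ℝ in nhdsWithin 0 (Set.Ioi 0), ε < 1 :=
    nhdsWithin_le_nhds (Iio_mem_nhds one_pos)
  obtain ⟨ε, hεmem, hε1, hε0⟩ := ((hcont.eventually (isOpen_interior.mem_nhds hc)).and
    (h1.and self_mem_nhdsWithin)).exists
  have hε0 : 0 < ε := hε0
  have h2 := hf.2 hcS hx (sub_nonneg.2 hε1.le) hε0.le (by ring)
  rw [hg (interior_subset hεmem), Convex.combo_affine_apply (by ring : (1 - ε) + ε = 1),
    hg (interior_subset hc)] at h2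
  simp only [smul_eq_mul] at h2
  exact le_of_mul_le_mul_left (by linarith) hε0

/-- The affine function of a cell of a regular triangulation is strictly below the convex function
at the vertices of the other cells. Otherwise the two would agree on a convex body larger than the
cell, and another cell would have the same affine function. -/
theorem IsTriangulation.lt_of_convexOn {S σ τ : Finset E} {t : Finset (Finset E)}
    (ht : IsTriangulation S t) {f : E → ℝ}
    {g : Finset E → (E →ᵃ[ℝ] ℝ)} (hf : ConvexOn ℝ (convexHull ℝ (S : Set E)) f)
    (hg : ∀ σ ∈ t, Set.EqOn f (g σ) (convexHull ℝ (σ : Set E)))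
    (hinj : Set.InjOn g (t : Set (Finset E))) (hσ : σ ∈ t) (hτ : τ ∈ t) {x : E} (hx : x ∈ τ)
    (hxσ : x ∉ σ) : g σ x < f x := by
  have hle : ∀ {σ}, σ ∈ t → ∀ {y}, y ∈ convexHull ℝ (S : Set E) → g σ y ≤ f y :=
    fun hσ _ hy => (ht.isSimplex hσ).le_of_convexOn (ht.subset _ hσ) hf (hg _ hσ) hy
  have hsub : ∀ {σ}, σ ∈ t → convexHull ℝ (σ : Set E) ⊆ convexHull ℝ (S : Set E) :=
    fun hσ => convexHull_mono (Finset.coe_subset.2 (ht.subset _ hσ))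
  have hxτ : x ∈ convexHull ℝ (τ : Set E) := subset_convexHull ℝ _ hx
  by_contra hcon
  -- `x` is not in the cell, by the face-to-face condition
  have hxn : x ∉ convexHull ℝ (σ : Set E) := by
    intro hxc
    have hxi : x ∈ convexHull ℝ ((σ : Set E) ∩ ↑τ) := by
      rw [← ht.inter σ hσ τ hτ]; exact ⟨hxc, hxτ⟩
    have h2 : bary τ x x ≤ (0 : E →ᵃ[ℝ] ℝ) x := by
      refine le_on_convexHull (fun z hz => ?_) hxi
      rw [(ht.isSimplex hτ).bary_of_ne hx hz.2 (fun e => hxσ (e ▸ hz.1))]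
      simp
    rw [(ht.isSimplex hτ).bary_self hx] at h2
    exact absurd h2 (not_le.2 one_pos)
  -- the convex set on which the convex function and the affine function agree
  set C : Set E := {z ∈ convexHull ℝ (S : Set E) | f z ≤ g σ z} with hC
  have hCconv : Convex ℝ C := by
    intro a ha b hb r s hr hs hrs
    refine ⟨convex_convexHull ℝ _ ha.1 hb.1 hr hs hrs, ?_⟩
    rw [Convex.combo_affine_apply hrs]
    refine (hf.2 ha.1 hb.1 hr hs hrs).trans ?_
    simp only [smul_eq_mul]
    have h1 := ha.2
    have h2 := hb.2
    gcongr
  have hσC : convexHull ℝ (σ : Set E) ⊆ C := fun z hz => ⟨hsub hσ hz, (hg σ hσ hz).le⟩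
  have hxC : x ∈ C := ⟨hsub hτ hxτ, not_lt.1 hcon⟩
  have hxcl : x ∈ closure (interior C) := by
    rw [hCconv.closure_interior_eq_closure_of_nonempty_interior
      ((ht.isSimplex hσ).interior_nonempty.mono (interior_mono hσC))]
    exact subset_closure hxC
  have hopen := (isClosed_convexHull_finset σ).isOpen_compl
  obtain ⟨z, hz1, hz2⟩ := mem_closure_iff.1 hxcl _ hopen hxn
  obtain ⟨p, ⟨hpC, hpσ⟩, hgen⟩ := exists_generic_point S (isOpen_interior.inter hopen)
    ⟨z, hz2, hz1⟩
  have hpS := (interior_subset hpC).1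
  rw [← ht.cover] at hpS
  obtain ⟨ρ, hρ, hpρ⟩ := Set.mem_iUnion₂.1 hpS
  have hρs := ht.isSimplex hρ
  have hpi : p ∈ interior (convexHull ℝ (ρ : Set E)) := hρs.mem_interior_iff.2 fun y hy =>
    lt_of_le_of_ne (hρs.mem_convexHull_iff.1 hpρ y hy)
      (hgen ρ (ht.subset ρ hρ) hρs y hy).symm
  have heq : g σ = g ρ := by
    refine eq_of_eqOn_open (isOpen_interior.inter isOpen_interior) ⟨p, hpC, hpi⟩ ?_
    rintro y ⟨hyC, hyρ⟩
    have hy := interior_subset hyC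
    rw [← hg ρ hρ (interior_subset hyρ)]
    exact le_antisymm (hle hσ hy.1) hy.2
  rw [← hinj hσ hρ heq] at hpρ
  exact hpσ hpρ

/-- Every regular triangulation comes from heights. Points of `S` that are not vertices are lifted
above the graph of the convex function. -/
theorem exists_eq_lowerCells {S : Finset E} (hS : GeneralPosition S) {t : Finset (Finset E)}
    (ht : IsRegularTriangulation S t) : ∃ w : E → ℝ, t = lowerCells S w := by
  classical
  obtain ⟨ht, f, g, hf, hg, hinj⟩ := ht
  set w : E → ℝ := fun x => if ∃ τ ∈ t, x ∈ τ then f x else f x + 1 with hw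
  refine ⟨w, eq_lowerCells_of_subset hS ht fun σ hσ => mem_lowerCells.2
    ⟨ht.subset σ hσ, ht.card_eq σ hσ, fun x hx hxσ => ?_⟩⟩
  have hs := ht.isSimplex hσ
  rw [hs.gap_eq_sub (g := g σ), sub_pos]
  · by_cases hex : ∃ τ ∈ t, x ∈ τ
    · rw [hw]
      simp only [hex, if_true]
      obtain ⟨τ, hτ, hxτ⟩ := hex
      exact ht.lt_of_convexOn hf hg hinj hσ hτ hxτ hxσ
    · rw [hw]
      simp only [hex, if_false]
      have := hs.le_of_convexOn (ht.subset _ hσ) hf (hg _ hσ) (subset_convexHull ℝ _ hx)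
      linarith
  · intro x hx
    have hex : ∃ τ ∈ t, x ∈ τ := ⟨σ, hσ, hx⟩
    rw [hw]
    simp only [hex, if_true]
    exact (hg σ hσ (subset_convexHull ℝ _ hx)).symm

/-! ### Volumes and the two triangulations of `d + 2` points -/

/-- Exchanging a vertex multiplies the volume by a barycentric coordinate: the affine map that
moves `y` to `x` and fixes the opposite facet is, up to a translation, a transvection. -/
theorem IsSimplex.volume_exchange [DecidableEq E] {σ : Finset E} (hσ : IsSimplex σ) {x y : E}
    (hy : y ∈ σ) :
    MeasureTheory.volume.real (convexHull ℝ ((insert x (σ.erase y) : Finset E) : Set E)) =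
      |bary σ y x| * MeasureTheory.volume.real (convexHull ℝ (σ : Set E)) := by
  set T : E →ₗ[ℝ] E := LinearMap.transvection (bary σ y).linear (x - y) with hT
  set c : E := bary σ y 0 • (x - y) with hc
  let A : E →ᵃ[ℝ] E := T.toAffineMap + AffineMap.const ℝ E c
  have hA : ∀ p, A p = p + bary σ y p • (x - y) := by
    intro p
    have h1 := congrFun (bary σ y).decomp p
    simp only [Pi.add_apply] at h1
    simp [A, hT, hc, LinearMap.transvection.apply, h1, add_smul, add_assoc]
  have hdet : LinearMap.det T = bary σ y x := by
    have h1 : (bary σ y).linear (x - y) = bary σ y x - bary σ y y := by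
      simpa using (bary σ y).linearMap_vsub x y
    rw [hT, LinearMap.transvection.det, h1, hσ.bary_self hy]
    ring
  have himg : A '' (σ : Set E) = ((insert x (σ.erase y) : Finset E) : Set E) := by
    have hAy : A y = x := by rw [hA, hσ.bary_self hy]; simp
    have hAz : ∀ z ∈ σ.erase y, A z = z := fun z hz => by
      rw [hA, hσ.bary_of_ne hy (Finset.mem_of_mem_erase hz) (Finset.ne_of_mem_erase hz).symm]
      simp
    rw [← Finset.insert_erase hy, Finset.coe_insert, Set.image_insert_eq, hAy,
      Finset.erase_insert (Finset.notMem_erase y σ), Finset.coe_insert]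
    congr 1
    exact (Set.image_congr hAz).trans (Set.image_id' _)
  have hsplit : A '' convexHull ℝ (σ : Set E) =
      (fun z => z + c) '' (T '' convexHull ℝ (σ : Set E)) := by
    rw [Set.image_image]; rfl
  rw [← himg, ← AffineMap.image_convexHull, hsplit, MeasureTheory.measureReal_def,
    Set.image_add_right, MeasureTheory.measure_preimage_add_right,
    MeasureTheory.Measure.addHaar_image_linearMap, hdet, ENNReal.toReal_mul,
    ENNReal.toReal_ofReal (abs_nonneg _), MeasureTheory.measureReal_def]

theorem IsSimplex.volume_pos {σ : Finset E} (hσ : IsSimplex σ) :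
    0 < MeasureTheory.volume.real (convexHull ℝ (σ : Set E)) := by
  refine ENNReal.toReal_pos (MeasureTheory.Measure.measure_pos_of_nonempty_interior _
    hσ.interior_nonempty).ne' ?_
  exact (Set.Finite.isCompact_convexHull ℝ σ.finite_toSet).measure_lt_top.ne

/-- The affine dependence `ν` of `d + 2` points in general position. It determines both the volumes
of the simplices spanned by the points and the heights of the lifted points over the opposite
simplices. -/
theorem exists_dependence [DecidableEq E] {Z : Finset E} (hZ : GeneralPosition Z)
    (hc : Z.card = d + 2) :
    ∃ (ν : E → ℝ) (V : ℝ), 0 < V ∧ ∑ y ∈ Z, ν y = 0 ∧ (∀ y ∈ Z, ν y ≠ 0) ∧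
      (∀ y ∈ Z, MeasureTheory.volume.real (convexHull ℝ (Z.erase y : Set E)) = |ν y| * V) ∧
      ∀ y ∈ Z, ∀ h : E → ℝ, ν y * gap (Z.erase y) y h = ∑ z ∈ Z, ν z * h z := by
  obtain ⟨x, hx⟩ : Z.Nonempty := by rw [← Finset.card_pos]; omega
  set σ := Z.erase x with hσdef
  have hs : ∀ y ∈ Z, IsSimplex (Z.erase y) := fun y hy =>
    hZ.isSimplex (Finset.erase_subset _ _) (by rw [Finset.card_erase_of_mem hy, hc]; rfl)
  have hσ : IsSimplex σ := hs x hx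
  have hxσ : x ∉ σ := Finset.notMem_erase x Z
  have hZσ : Z = insert x σ := (Finset.insert_erase hx).symm
  have hne : ∀ y ∈ σ, y ≠ x := fun y hy e => hxσ (e ▸ hy)
  set ν : E → ℝ := fun y => if y = x then 1 else -bary σ y x with hν
  have hνx : ν x = 1 := if_pos rfl
  have hνσ : ∀ y ∈ σ, ν y = -bary σ y x := fun y hy => if_neg (hne y hy)
  have hsum : ∀ h : E → ℝ, ∑ z ∈ Z, ν z * h z = gap σ x h := by
    intro h
    rw [hZσ, Finset.sum_insert hxσ, hνx, gap, interp_apply, Finset.sum_congr rfl fun y hy => by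
      rw [hνσ y hy], sub_eq_add_neg, one_mul, ← Finset.sum_neg_distrib]
    congr 1
    exact Finset.sum_congr rfl fun y _ => by ring
  have hers : ∀ y ∈ σ, Z.erase y = insert x (σ.erase y) := fun y hy => by
    rw [hZσ, Finset.erase_insert_of_ne (hne y hy).symm]
  refine ⟨ν, MeasureTheory.volume.real (convexHull ℝ (σ : Set E)), hσ.volume_pos, ?_, ?_, ?_, ?_⟩
  · rw [hZσ, Finset.sum_insert hxσ, hνx, Finset.sum_congr rfl hνσ, Finset.sum_neg_distrib,
      hσ.sum_bary, add_neg_cancel]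
  · intro y hy
    rw [hZσ] at hy
    rcases Finset.mem_insert.1 hy with rfl | hy
    · rw [hνx]; exact one_ne_zero
    · rw [hνσ y hy]
      exact neg_ne_zero.2 (hZ.bary_ne_zero (Finset.erase_subset _ _) hσ hx hxσ hy)
  · intro y hy
    rw [hZσ] at hy
    rcases Finset.mem_insert.1 hy with rfl | hy
    · rw [hνx, abs_one, one_mul]
    · rw [hνσ y hy, abs_neg, hers y hy, hσ.volume_exchange hy]
  · intro y hyZ h
    rw [hsum]
    have hy := hyZ
    rw [hZσ] at hy
    rcases Finset.mem_insert.1 hy with rfl | hy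
    · rw [hνx, one_mul]
    · have hA := hs y hyZ
      have hmem : ∀ z ∈ Z, z ≠ y → interp (Z.erase y) h z = h z := fun z hz hzy =>
        hA.interp_of_mem h (Finset.mem_erase.2 ⟨hzy, hz⟩)
      have h1 : gap σ x h = ∑ z ∈ σ, bary σ z x * (interp (Z.erase y) h z - h z) := by
        simp only [mul_sub, Finset.sum_sub_distrib]
        rw [← hσ.apply_eq_sum, hmem x hx (hne y hy).symm, gap, interp_apply]
        congr 1
        exact Finset.sum_congr rfl fun y _ => mul_comm _ _
      rw [h1, Finset.sum_eq_single y, hνσ y hy, gap]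
      · ring
      · intro z hz hzy
        rw [hmem z (Finset.mem_of_mem_erase hz) hzy, sub_self, mul_zero]
      · exact fun h => absurd hy h

theorem lowerCells_eq_image [DecidableEq E] {Z : Finset E} (hc : Z.card = d + 2) (h : E → ℝ) :
    lowerCells Z h = (Z.filter fun y => 0 < gap (Z.erase y) y h).image fun y => Z.erase y := by
  ext σ
  rw [mem_lowerCells, Finset.mem_image]
  constructor
  · rintro ⟨hσ, hσc, H⟩
    obtain ⟨y, hyσ, rfl⟩ := (Finset.covBy_iff_exists_insert (s := σ) (t := Z)).1
      (Finset.covBy_iff_card_sdiff_eq_one.2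
        ⟨hσ, by rw [Finset.card_sdiff_of_subset hσ, hc, hσc]; omega⟩)
    refine ⟨y, Finset.mem_filter.2 ⟨Finset.mem_insert_self _ _, ?_⟩, Finset.erase_insert hyσ⟩
    rw [Finset.erase_insert hyσ]
    exact H y (Finset.mem_insert_self _ _) hyσ
  · rintro ⟨y, hy, rfl⟩
    obtain ⟨hyZ, hpos⟩ := Finset.mem_filter.1 hy
    refine ⟨Finset.erase_subset _ _, by rw [Finset.card_erase_of_mem hyZ, hc]; rfl, ?_⟩
    intro x hx hxy
    have : x = y := by
      by_contra hne
      exact hxy (Finset.mem_erase.2 ⟨hne, hx⟩)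
    rwa [this]

/-- Of the two triangulations of `d + 2` points, the one below on the paraboloid has the smaller
parabolic functional. Up to a positive factor the difference is the square of the height of the
lifted points over the opposite simplices. -/
theorem Vr_lowerCells_lt {Z : Finset E} (hZ : GeneralPosition Z) (hc : Z.card = d + 2)
    {h k : E → ℝ} (hh : ∀ σ ⊆ Z, ∀ x ∈ Z, insert x σ = Z → x ∉ σ →
      (0 < gap σ x h ↔ gap σ x paraboloid < 0))
    (hk : ∀ σ ⊆ Z, ∀ x ∈ Z, insert x σ = Z → x ∉ σ →
      (0 < gap σ x k ↔ 0 < gap σ x paraboloid)) :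
    Vr (lowerCells Z k) < Vr (lowerCells Z h) := by
  classical
  obtain ⟨ν, V, hV, hν0, hν, hvol, hgap⟩ := exists_dependence hZ hc
  set Q := ∑ z ∈ Z, paraboloid z with hQ
  set c := ∑ z ∈ Z, ν z * paraboloid z with hcdef
  have hVr : ∀ l : E → ℝ, Vr (lowerCells Z l) =
      ∑ y ∈ Z.filter (fun y => 0 < gap (Z.erase y) y l), (Q - paraboloid y) * (|ν y| * V) := by
    intro l
    rw [lowerCells_eq_image hc, Vr, Finset.sum_image]
    · refine Finset.sum_congr rfl fun y hy => ?_
      have hyZ := (Finset.mem_filter.1 hy).1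
      rw [hvol y hyZ, hQ, ← Finset.add_sum_erase Z _ hyZ, add_sub_cancel_left]
      rfl
    · exact (Finset.erase_injOn Z).mono fun y hy => (Finset.mem_filter.1 hy).1
  have hins : ∀ y ∈ Z, insert y (Z.erase y) = Z := fun y hy => Finset.insert_erase hy
  have hkf : Z.filter (fun y => 0 < gap (Z.erase y) y k) = Z.filter (fun y => 0 < ν y * c) := by
    refine Finset.filter_congr fun y hy => ?_
    rw [hk _ (Finset.erase_subset _ _) y hy (hins y hy) (Finset.notMem_erase y Z),
      hcdef, ← hgap y hy, ← mul_assoc, mul_pos_iff_of_pos_left (mul_self_pos.2 (hν y hy))]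
  have hhf : Z.filter (fun y => 0 < gap (Z.erase y) y h) = Z.filter (fun y => ν y * c < 0) := by
    refine Finset.filter_congr fun y hy => ?_
    rw [hh _ (Finset.erase_subset _ _) y hy (hins y hy) (Finset.notMem_erase y Z),
      hcdef, ← hgap y hy, ← mul_assoc, ← smul_eq_mul,
      smul_neg_iff_of_pos_left (mul_self_pos.2 (hν y hy))]
  have hc0 : c ≠ 0 := by
    obtain ⟨y, hy⟩ : Z.Nonempty := by rw [← Finset.card_pos]; omega
    rw [hcdef, ← hgap y hy]
    exact mul_ne_zero (hν y hy) (hZ.gap_paraboloid_ne_zero (Finset.erase_subset _ _)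
      (hZ.isSimplex (Finset.erase_subset _ _) (by rw [Finset.card_erase_of_mem hy, hc]; rfl)) hy
      (Finset.notMem_erase y Z))
  -- the factor `|c|` makes the two sums, over the signs of `ν y * c`, into one sum over `Z`
  have key : |c| * (Vr (lowerCells Z k) - Vr (lowerCells Z h)) = -(V * c ^ 2) := by
    have h1 : |c| * (Vr (lowerCells Z k) - Vr (lowerCells Z h)) =
        ∑ y ∈ Z, (Q - paraboloid y) * (ν y * c) * V := by
      rw [hVr, hVr, hkf, hhf, Finset.sum_filter, Finset.sum_filter, ← Finset.sum_sub_distrib,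
        Finset.mul_sum]
      refine Finset.sum_congr rfl fun y hy => ?_
      have habs : |ν y| * |c| = |ν y * c| := (abs_mul _ _).symm
      rcases lt_or_gt_of_ne (mul_ne_zero (hν y hy) hc0) with hlt | hgt
      · rw [if_neg (not_lt.2 hlt.le), if_pos hlt]
        rw [abs_of_neg hlt] at habs
        linear_combination (-(Q - paraboloid y) * V) * habs
      · rw [if_pos hgt, if_neg (not_lt.2 hgt.le)]
        rw [abs_of_pos hgt] at habs
        linear_combination ((Q - paraboloid y) * V) * habs
    rw [h1, ← Finset.sum_mul]
    simp only [sub_mul, Finset.sum_sub_distrib, ← Finset.mul_sum, ← Finset.sum_mul]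
    rw [hν0]
    have h2 : ∑ y ∈ Z, paraboloid y * (ν y * c) = c * c := by
      conv_rhs => rw [hcdef, Finset.sum_mul]
      exact Finset.sum_congr rfl fun y _ => by ring
    rw [h2]; ring
  have hpos : 0 < V * c ^ 2 := by positivity
  have := abs_pos.2 hc0
  by_contra hcon
  have := mul_nonneg this.le (sub_nonneg.2 (not_lt.1 hcon))
  linarith

/-! ### Crossing a critical height function -/

/-- The pairs of a `d`-simplex with vertices in `S` and a further point of `S`. -/
noncomputable def simplexPointPairs (S : Finset E) : Finset (Finset E × E) :=
  ((S.powersetCard (d + 1)) ×ˢ S).filter (fun a => a.2 ∉ a.1)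

theorem mem_simplexPointPairs {S : Finset E} {a : Finset E × E} :
    a ∈ simplexPointPairs S ↔ (a.1 ⊆ S ∧ a.1.card = d + 1) ∧ a.2 ∈ S ∧ a.2 ∉ a.1 := by
  rw [simplexPointPairs, Finset.mem_filter, Finset.mem_product, Finset.mem_powersetCard, and_assoc]

/-- A small multiple of `k` changes no sign among finitely many nonzero gaps of `h`. -/
theorem exists_small (S : Finset E) (h k : E → ℝ) :
    ∃ ε > 0, ∀ a ∈ simplexPointPairs S, gap a.1 a.2 h ≠ 0 →
      ε * |gap a.1 a.2 k| < |gap a.1 a.2 h| := by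
  have hev : ∀ᶠ ε : ℝ in nhdsWithin 0 (Set.Ioi 0), ∀ a ∈ simplexPointPairs S,
      gap a.1 a.2 h ≠ 0 → ε * |gap a.1 a.2 k| < |gap a.1 a.2 h| := by
    rw [Filter.eventually_all_finset]
    intro a _
    by_cases h0 : gap a.1 a.2 h = 0
    · exact Filter.Eventually.of_forall fun _ h1 => absurd h0 h1
    · have hcont : Continuous fun ε : ℝ => ε * |gap a.1 a.2 k| := by fun_prop
      have ht := hcont.tendsto 0
      rw [zero_mul] at ht
      have := ht.eventually (Iio_mem_nhds (abs_pos.2 h0))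
      exact (this.filter_mono nhdsWithin_le_nhds).mono fun ε hε _ => hε
  obtain ⟨ε, hε, hε0⟩ := (hev.and self_mem_nhdsWithin).exists
  exact ⟨ε, hε0, hε⟩

theorem pos_add_iff {a b ε : ℝ} (h : |ε * b| < |a|) : 0 < a + ε * b ↔ 0 < a := by
  rcases abs_cases a with ⟨h1, h2⟩ | ⟨h1, h2⟩ <;>
  rcases abs_cases (ε * b) with ⟨h3, h4⟩ | ⟨h3, h4⟩ <;>
  constructor <;> intro <;> linarith

theorem Vr_lt_of_exchange {t t' T₁ T₂ : Finset (Finset E)} (h₁ : T₁ ⊆ t) (h₂ : T₂ ⊆ t')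
    (h : ∀ σ, (σ ∈ t ∧ σ ∉ T₁) ↔ (σ ∈ t' ∧ σ ∉ T₂)) (hlt : Vr T₂ < Vr T₁) : Vr t' < Vr t := by
  classical
  have he : t \ T₁ = t' \ T₂ := by
    ext σ; simpa only [Finset.mem_sdiff] using h σ
  rw [Vr, Vr, ← Finset.sum_sdiff h₁, ← Finset.sum_sdiff h₂, he]
  exact add_lt_add_right hlt _

theorem mem_of_insert_eq {Z : Finset E} {σ : Finset E} {x : E} (h : insert x σ = Z) :
    σ ⊆ Z ∧ x ∈ Z :=
  h ▸ ⟨Finset.subset_insert _ _, Finset.mem_insert_self _ _⟩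

theorem insert_eq_of_card {Z : Finset E} (hc : Z.card = d + 2) {σ : Finset E} (hσ : σ ⊆ Z)
    (hσc : σ.card = d + 1) {x : E} (hx : x ∈ Z) (hxσ : x ∉ σ) : insert x σ = Z :=
  Finset.eq_of_subset_of_card_le (Finset.insert_subset hx hσ)
    (by rw [Finset.card_insert_of_notMem hxσ, hσc, hc])

/-- The heights `w` are critical at `Z`: the `d + 2` points of `Z` are lifted to one hyperplane,
strictly below the other points of `S`, and no other `d + 2` points are lifted to a hyperplane. -/
structure IsCritical (S Z : Finset E) (w : E → ℝ) : Prop where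
  subset : Z ⊆ S
  card_eq : Z.card = d + 2
  exists_affine : ∃ g : E →ᵃ[ℝ] ℝ, (∀ x ∈ Z, g x = w x) ∧ ∀ x ∈ S, x ∉ Z → g x < w x
  gap_ne_zero : ∀ a ∈ simplexPointPairs S, insert a.2 a.1 ≠ Z → gap a.1 a.2 w ≠ 0

theorem IsCritical.gap_eq_zero {S Z : Finset E} {w : E → ℝ}
    (hS : GeneralPosition S) (hw : IsCritical S Z w) {σ : Finset E}
    {x : E} (hσc : σ.card = d + 1) (h : insert x σ = Z) : gap σ x w = 0 := by
  obtain ⟨g, hg, -⟩ := hw.exists_affine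
  obtain ⟨hσ, hx⟩ := mem_of_insert_eq h
  rw [(hS.isSimplex (hσ.trans hw.subset) hσc).gap_eq_sub (g := g) (fun y hy => hg y (hσ hy)),
    hg x hx, sub_self]

theorem IsCritical.gap_pos {S Z : Finset E} {w : E → ℝ}
    (hS : GeneralPosition S) (hw : IsCritical S Z w) {σ : Finset E}
    {x : E} (hσ : σ ⊆ Z) (hσc : σ.card = d + 1) (hx : x ∈ S) (hxZ : x ∉ Z) : 0 < gap σ x w := by
  obtain ⟨g, hg, hg'⟩ := hw.exists_affine
  rw [(hS.isSimplex (hσ.trans hw.subset) hσc).gap_eq_sub (g := g) (fun y hy => hg y (hσ hy))]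
  exact sub_pos.2 (hg' x hx hxZ)

/-- The number `δ` is small enough for the gaps of `w` that are not zero to keep their signs when
`δ` times the paraboloid is added. -/
def IsSmallFor (S : Finset E) (w : E → ℝ) (δ : ℝ) : Prop :=
  ∀ a ∈ simplexPointPairs S, gap a.1 a.2 w ≠ 0 →
    (0 < gap a.1 a.2 (w + δ • paraboloid) ↔ 0 < gap a.1 a.2 w) ∧
      gap a.1 a.2 (w + δ • paraboloid) ≠ 0

theorem isSmallFor_of_abs {S : Finset E} {w : E → ℝ} {δ : ℝ}
    (h : ∀ a ∈ simplexPointPairs S, gap a.1 a.2 w ≠ 0 →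
    |δ| * |gap a.1 a.2 paraboloid| < |gap a.1 a.2 w|) : IsSmallFor S w δ := by
  intro a ha h0
  have h1 := h a ha h0
  rw [← abs_mul] at h1
  rw [gap_add_smul]
  refine ⟨pos_add_iff h1, fun h2 => ?_⟩
  rw [add_eq_zero_iff_eq_neg.1 h2, abs_neg] at h1
  exact lt_irrefl _ h1

theorem IsCritical.isGeneric {S Z : Finset E} {w : E → ℝ}
    (hS : GeneralPosition S) (hw : IsCritical S Z w) {δ : ℝ}
    (hδ0 : δ ≠ 0) (hδ : IsSmallFor S w δ) : IsGeneric S (w + δ • paraboloid) := by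
  intro σ hσ hs x hx hxσ
  by_cases hZ : insert x σ = Z
  · rw [gap_add_smul, hw.gap_eq_zero hS hs.card_eq hZ, zero_add]
    exact mul_ne_zero hδ0 (hS.gap_paraboloid_ne_zero hσ hs hx hxσ)
  · have ha : (σ, x) ∈ simplexPointPairs S := mem_simplexPointPairs.2 ⟨⟨hσ, hs.card_eq⟩, hx, hxσ⟩
    exact (hδ _ ha (hw.gap_ne_zero _ ha hZ)).2

theorem IsGeneric.mono {S Z : Finset E} {h : E → ℝ} (hh : IsGeneric S h) (hZ : Z ⊆ S) :
    IsGeneric Z h :=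
  fun σ hσ hs x hx hxσ => hh σ (hσ.trans hZ) hs x (hZ hx) hxσ

/-- Near a critical height function the lower cells of `Z` are the lower cells of `S` inside `Z`. -/
theorem IsCritical.mem_lowerCells_iff {S Z : Finset E} {w : E → ℝ}
    (hS : GeneralPosition S) (hw : IsCritical S Z w) {δ : ℝ}
    (hδ : IsSmallFor S w δ) {σ : Finset E} :
    σ ∈ lowerCells Z (w + δ • paraboloid) ↔ σ ∈ lowerCells S (w + δ • paraboloid) ∧ σ ⊆ Z := by
  rw [mem_lowerCells, mem_lowerCells]
  constructor
  · rintro ⟨hσ, hσc, H⟩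
    refine ⟨⟨hσ.trans hw.subset, hσc, fun x hx hxσ => ?_⟩, hσ⟩
    by_cases hxZ : x ∈ Z
    · exact H x hxZ hxσ
    · have hpos := hw.gap_pos hS hσ hσc hx hxZ
      exact (hδ (σ, x) (mem_simplexPointPairs.2 ⟨⟨hσ.trans hw.subset, hσc⟩, hx, hxσ⟩)
        hpos.ne').1.2 hpos
  · rintro ⟨⟨_, hσc, H⟩, hσ⟩
    exact ⟨hσ, hσc, fun x hx hxσ => H x (hw.subset hx) hxσ⟩

/-- Cells that are not inside `Z` survive on both sides of the critical height function. -/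
theorem IsCritical.mem_lowerCells_of_not_subset {S Z : Finset E} {w : E → ℝ}
    (hw : IsCritical S Z w) {δ δ' : ℝ}
    (hδ : IsSmallFor S w δ) (hδ' : IsSmallFor S w δ') {σ : Finset E} (hσZ : ¬ σ ⊆ Z)
    (h : σ ∈ lowerCells S (w + δ • paraboloid)) : σ ∈ lowerCells S (w + δ' • paraboloid) := by
  obtain ⟨hσ, hσc, H⟩ := mem_lowerCells.1 h
  refine mem_lowerCells.2 ⟨hσ, hσc, fun x hx hxσ => ?_⟩
  have ha : (σ, x) ∈ simplexPointPairs S := mem_simplexPointPairs.2 ⟨⟨hσ, hσc⟩, hx, hxσ⟩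
  have h0 := hw.gap_ne_zero _ ha (fun h => hσZ (mem_of_insert_eq h).1)
  exact (hδ' _ ha h0).1.2 ((hδ _ ha h0).1.1 (H x hx hxσ))

/-- Moving across a critical height function in the direction of the paraboloid is a flip that
decreases the parabolic functional. -/
theorem IsCritical.isFlip {S Z : Finset E} {w : E → ℝ} {ε : ℝ}
    (hS : GeneralPosition S) (hw : IsCritical S Z w) (hε : 0 < ε)
    (hpos : IsSmallFor S w ε) (hneg : IsSmallFor S w (-ε)) :
    IsFlip S (lowerCells S (w + (-ε) • paraboloid)) (lowerCells S (w + ε • paraboloid)) ∧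
      Vr (lowerCells S (w + ε • paraboloid)) < Vr (lowerCells S (w + (-ε) • paraboloid)) := by
  have hZ := hS.mono hw.subset
  have hcard : d + 1 ≤ Z.card := by rw [hw.card_eq]; omega
  have ht₁ : IsTriangulation Z (lowerCells Z (w + (-ε) • paraboloid)) :=
    isTriangulation_lowerCells hZ hcard
      ((hw.isGeneric hS (neg_ne_zero.2 hε.ne') hneg).mono hw.subset)
  have ht₂ : IsTriangulation Z (lowerCells Z (w + ε • paraboloid)) :=
    isTriangulation_lowerCells hZ hcard ((hw.isGeneric hS hε.ne' hpos).mono hw.subset)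
  have hgap : ∀ {σ x}, σ.card = d + 1 → insert x σ = Z → ∀ δ,
      gap σ x (w + δ • paraboloid) = δ * gap σ x paraboloid := fun hσc h δ => by
    rw [gap_add_smul, hw.gap_eq_zero hS hσc h, zero_add]
  have hsub₁ : lowerCells Z (w + (-ε) • paraboloid) ⊆ lowerCells S (w + (-ε) • paraboloid) :=
    fun σ hσ => ((hw.mem_lowerCells_iff hS hneg).1 hσ).1
  have hsub₂ : lowerCells Z (w + ε • paraboloid) ⊆ lowerCells S (w + ε • paraboloid) :=
    fun σ hσ => ((hw.mem_lowerCells_iff hS hpos).1 hσ).1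
  have hexch : ∀ σ, (σ ∈ lowerCells S (w + (-ε) • paraboloid) ∧
      σ ∉ lowerCells Z (w + (-ε) • paraboloid)) ↔
      (σ ∈ lowerCells S (w + ε • paraboloid) ∧ σ ∉ lowerCells Z (w + ε • paraboloid)) := by
    intro σ
    rw [hw.mem_lowerCells_iff hS hpos, hw.mem_lowerCells_iff hS hneg]
    constructor
    · rintro ⟨h1, h2⟩
      have hσZ : ¬ σ ⊆ Z := fun h => h2 ⟨h1, h⟩
      exact ⟨hw.mem_lowerCells_of_not_subset hneg hpos hσZ h1, fun h => hσZ h.2⟩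
    · rintro ⟨h1, h2⟩
      have hσZ : ¬ σ ⊆ Z := fun h => h2 ⟨h1, h⟩
      exact ⟨hw.mem_lowerCells_of_not_subset hpos hneg hσZ h1, fun h => hσZ h.2⟩
  refine ⟨⟨Z, _, _, hw.subset, hw.card_eq, ht₁, ht₂, ?_, hsub₁, ?_⟩, ?_⟩
  · -- the gap of a common cell would have both signs
    intro heq
    obtain ⟨z, hz⟩ : Z.Nonempty := by rw [← Finset.card_pos]; omega
    have hzc := subset_convexHull ℝ (Z : Set E) hz
    rw [← ht₁.cover] at hzc
    obtain ⟨σ, hσ, -⟩ := Set.mem_iUnion₂.1 hzc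
    obtain ⟨hσZ, hσc, H₁⟩ := mem_lowerCells.1 hσ
    rw [heq] at hσ
    obtain ⟨x, hx, hxσ⟩ := Finset.exists_mem_notMem_of_card_lt_card
      (s := σ) (t := Z) (by rw [hσc, hw.card_eq]; omega)
    have hins := insert_eq_of_card hw.card_eq hσZ hσc hx hxσ
    have h1 := H₁ x hx hxσ
    have h2 := (mem_lowerCells.1 hσ).2.2 x hx hxσ
    rw [hgap hσc hins] at h1 h2
    linarith
  · ext σ
    simp only [Set.mem_union, Set.mem_sdiff, Finset.mem_coe]
    rw [hexch σ]
    constructor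
    · intro h
      by_cases h' : σ ∈ lowerCells Z (w + ε • paraboloid)
      · exact Or.inr h'
      · exact Or.inl ⟨h, h'⟩
    · rintro (h | h)
      · exact h.1
      · exact hsub₂ h
  · refine Vr_lt_of_exchange hsub₁ hsub₂ hexch (Vr_lowerCells_lt hZ hw.card_eq ?_ ?_)
    all_goals
      intro σ _ x _ hins hxσ
      have hσc : σ.card = d + 1 := by
        have := Finset.card_insert_of_notMem hxσ
        rw [hins, hw.card_eq] at this
        omega
      rw [hgap hσc hins]
    · rw [neg_mul, neg_pos]
      exact smul_neg_iff_of_pos_left hε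
    · exact mul_pos_iff_of_pos_left hε

/-! ### Generic heights and the first critical moment -/

/-- `gap` as a linear functional of the heights. -/
noncomputable def gapLinear (σ : Finset E) (x : E) : (E → ℝ) →ₗ[ℝ] ℝ where
  toFun := gap σ x
  map_add' := gap_add σ x
  map_smul' := gap_smul σ x

@[simp] theorem gapLinear_apply (σ : Finset E) (x : E) (h : E → ℝ) :
    gapLinear σ x h = gap σ x h := rfl

theorem gap_single_eq_zero {σ : Finset E} {x z : E} (hz : z ∉ insert x σ) :
    gap σ x (Pi.single z 1) = 0 := by
  rw [Finset.mem_insert, not_or] at hz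
  rw [gap, interp_apply, Pi.single_eq_of_ne (Ne.symm hz.1), Finset.sum_eq_zero, sub_zero]
  intro y hy
  rw [Pi.single_eq_of_ne (fun e : y = z => hz.2 (e ▸ hy)), zero_mul]

theorem gap_single_ne_zero {S σ : Finset E} {x z : E} (hS : GeneralPosition S) (hσS : σ ⊆ S)
    (hσ : IsSimplex σ) (hx : x ∈ S) (hxσ : x ∉ σ) (hz : z ∈ insert x σ) :
    gap σ x (Pi.single z 1) ≠ 0 := by
  rcases Finset.mem_insert.1 hz with rfl | hzσ
  · rw [gap, interp_apply, Pi.single_eq_same, Finset.sum_eq_zero]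
    · simp
    · intro y hy
      rw [Pi.single_eq_of_ne (fun e : y = z => hxσ (e ▸ hy)), zero_mul]
  · rw [gap, interp_apply, Pi.single_eq_of_ne (fun e : x = z => hxσ (e ▸ hzσ)),
      Finset.sum_eq_single_of_mem z hzσ, Pi.single_eq_same, one_mul, zero_sub]
    · exact neg_ne_zero.2 (hS.bary_ne_zero hσS hσ hx hxσ hzσ)
    · intro y _ hy
      rw [Pi.single_eq_of_ne hy, zero_mul]

/-- The heights of a triangulation can be perturbed so that different sets of `d + 2` points become
coplanar at different moments on the way to the paraboloid. -/
theorem exists_generic_heights {S : Finset E} (hS : GeneralPosition S) (w₀ : E → ℝ) :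
    ∃ w : E → ℝ, lowerCells S w₀ ⊆ lowerCells S w ∧
      ∀ a ∈ simplexPointPairs S, ∀ b ∈ simplexPointPairs S,
        insert a.2 a.1 ≠ insert b.2 b.1 →
        gap a.1 a.2 w * gap b.1 b.2 paraboloid ≠ gap b.1 b.2 w * gap a.1 a.2 paraboloid := by
  classical
  let P := ((simplexPointPairs S) ×ˢ (simplexPointPairs S)).filter
    (fun c => insert c.1.2 c.1.1 ≠ insert c.2.2 c.2.1)
  let L : (Finset E × E) × (Finset E × E) → Module.Dual ℝ (E → ℝ) := fun c =>
    gap c.2.1 c.2.2 paraboloid • gapLinear c.1.1 c.1.2 -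
      gap c.1.1 c.1.2 paraboloid • gapLinear c.2.1 c.2.2
  have hL : ∀ c h, L c h = gap c.1.1 c.1.2 h * gap c.2.1 c.2.2 paraboloid -
      gap c.2.1 c.2.2 h * gap c.1.1 c.1.2 paraboloid := by
    intro c h; simp [L]; ring
  obtain ⟨v, hv⟩ := Module.Dual.exists_forall_ne_zero_of_forall_exists (K := ℝ)
    (fun c : P => L c) (by
    rintro ⟨⟨a, b⟩, hc⟩
    obtain ⟨hc, hne⟩ := Finset.mem_filter.1 hc
    obtain ⟨ha, hb⟩ := Finset.mem_product.1 hc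
    obtain ⟨⟨haS, hac⟩, hax, haσ⟩ := mem_simplexPointPairs.1 ha
    obtain ⟨⟨hbS, hbc⟩, hbx, hbσ⟩ := mem_simplexPointPairs.1 hb
    obtain ⟨z, hza, hzb⟩ : ∃ z ∈ insert a.2 a.1, z ∉ insert b.2 b.1 := by
      by_contra! hcon
      refine hne (Finset.eq_of_subset_of_card_le hcon ?_)
      simp only at haσ hbσ ⊢
      rw [Finset.card_insert_of_notMem haσ, Finset.card_insert_of_notMem hbσ, hac, hbc]
    refine ⟨Pi.single z 1, ?_⟩
    rw [hL]
    simp only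
    rw [gap_single_eq_zero hzb, zero_mul, sub_zero]
    exact mul_ne_zero
      (gap_single_ne_zero hS haS (hS.isSimplex haS hac) hax haσ hza)
      (hS.gap_paraboloid_ne_zero hbS (hS.isSimplex hbS hbc) hbx hbσ))
  have hne : ∀ᶠ ε : ℝ in nhdsWithin 0 (Set.Ioi 0), ∀ c ∈ P, L c (w₀ + ε • v) ≠ 0 := by
    rw [Filter.eventually_all_finset]
    intro c hc
    have hvc : L c v ≠ 0 := hv ⟨c, hc⟩
    simp only [map_add, map_smul, smul_eq_mul]
    by_cases h0 : L c w₀ = 0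
    · filter_upwards [self_mem_nhdsWithin] with ε hε
      rw [h0, zero_add]
      exact mul_ne_zero (ne_of_gt hε) hvc
    · have hcont : Continuous fun ε : ℝ => L c w₀ + ε * L c v := by fun_prop
      have := (hcont.continuousAt (x := 0)).eventually_ne
        (g := fun ε => L c w₀ + ε * L c v) (y := 0) (by simpa using h0)
      exact this.filter_mono nhdsWithin_le_nhds
  have hpos : ∀ᶠ ε : ℝ in nhdsWithin 0 (Set.Ioi 0), ∀ a ∈ simplexPointPairs S,
      0 < gap a.1 a.2 w₀ → 0 < gap a.1 a.2 (w₀ + ε • v) := by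
    rw [Filter.eventually_all_finset]
    intro a _
    rw [Filter.eventually_imp_distrib_left]
    intro h0
    simp only [gap_add_smul]
    have hcont : Continuous fun ε : ℝ => gap a.1 a.2 w₀ + ε * gap a.1 a.2 v := by fun_prop
    have ht := hcont.tendsto 0
    rw [zero_mul, add_zero] at ht
    exact (ht.eventually (Ioi_mem_nhds h0)).filter_mono nhdsWithin_le_nhds
  obtain ⟨ε, h1, h2⟩ := (hne.and hpos).exists
  refine ⟨w₀ + ε • v, fun σ hσ => ?_, fun a ha b hb hab => ?_⟩
  · obtain ⟨hσS, hσc, H⟩ := mem_lowerCells.1 hσ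
    exact mem_lowerCells.2 ⟨hσS, hσc, fun x hx hxσ =>
      h2 (σ, x) (mem_simplexPointPairs.2 ⟨⟨hσS, hσc⟩, hx, hxσ⟩) (H x hx hxσ)⟩
  · have := h1 (a, b) (Finset.mem_filter.2 ⟨Finset.mem_product.2 ⟨ha, hb⟩, hab⟩)
    rw [hL] at this
    exact sub_ne_zero.1 this

/-- Moving the heights of a regular triangulation towards the paraboloid, the first moment at which
the triangulation changes is a decreasing flip. -/
theorem exists_flip {S : Finset E} (hS : GeneralPosition S) {t : Finset (Finset E)}
    (ht : IsRegularTriangulation S t) (hne : t ≠ delaunay S) :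
    ∃ t', IsRegularTriangulation S t' ∧ IsFlip S t t' ∧ Vr t' < Vr t := by
  classical
  obtain ⟨w₀, hw₀⟩ := exists_eq_lowerCells hS ht
  obtain ⟨w, hsub, hgen⟩ := exists_generic_heights hS w₀
  rw [← hw₀] at hsub
  -- the pairs that obstruct `t` from being the Delaunay triangulation
  let P := (simplexPointPairs S).filter (fun a => a.1 ∈ t ∧ gap a.1 a.2 paraboloid < 0)
  have hP : P.Nonempty := by
    by_contra hP
    rw [Finset.not_nonempty_iff_eq_empty] at hP
    refine hne ?_
    rw [← lowerCells_paraboloid hS]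
    refine eq_lowerCells_of_subset hS ht.1 fun σ hσ => mem_lowerCells.2
      ⟨ht.1.subset σ hσ, ht.1.card_eq σ hσ, fun x hx hxσ => ?_⟩
    by_contra hcon
    have : (σ, x) ∈ P := Finset.mem_filter.2
      ⟨mem_simplexPointPairs.2 ⟨⟨ht.1.subset σ hσ, ht.1.card_eq σ hσ⟩, hx, hxσ⟩, hσ,
        lt_of_le_of_ne (not_lt.1 hcon) (hS.gap_paraboloid_ne_zero (ht.1.subset σ hσ)
          (ht.1.isSimplex hσ) hx hxσ)⟩
    rw [hP] at this
    exact Finset.notMem_empty _ this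
  have hwpos : ∀ σ ∈ t, ∀ x ∈ S, x ∉ σ → 0 < gap σ x w := fun σ hσ =>
    (mem_lowerCells.1 (hsub hσ)).2.2
  obtain ⟨⟨σ₀, x₀⟩, ha₀, hmin⟩ := P.exists_min_image
    (fun a => gap a.1 a.2 w / -gap a.1 a.2 paraboloid) hP
  obtain ⟨hpair, hσ₀t, hneg₀⟩ := Finset.mem_filter.1 ha₀
  obtain ⟨⟨hσ₀S, hσ₀c⟩, hx₀, hx₀σ⟩ := mem_simplexPointPairs.1 hpair
  simp only at hσ₀t hneg₀ hσ₀S hσ₀c hx₀ hx₀σ hmin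
  set u := gap σ₀ x₀ w / -gap σ₀ x₀ paraboloid with hu
  have hu0 : 0 < u := div_pos (hwpos σ₀ hσ₀t x₀ hx₀ hx₀σ) (neg_pos.2 hneg₀)
  set w' := w + u • paraboloid with hw'
  have hgap' : ∀ σ x, gap σ x w' = gap σ x w + u * gap σ x paraboloid := fun σ x =>
    gap_add_smul σ x w paraboloid u
  have hueq : u * gap σ₀ x₀ paraboloid = -gap σ₀ x₀ w := by
    rw [hu, div_neg, neg_mul, div_mul_cancel₀ _ hneg₀.ne]
  have hzero : gap σ₀ x₀ w' = 0 := by rw [hgap', hueq, add_neg_cancel]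
  have hnonneg : ∀ σ ∈ t, ∀ x ∈ S, x ∉ σ → 0 ≤ gap σ x w' := by
    intro σ hσ x hx hxσ
    have h1 := hwpos σ hσ x hx hxσ
    rw [hgap']
    rcases le_or_gt 0 (gap σ x paraboloid) with h2 | h2
    · positivity
    · have := hmin (σ, x) (Finset.mem_filter.2 ⟨mem_simplexPointPairs.2
        ⟨⟨ht.1.subset σ hσ, ht.1.card_eq σ hσ⟩, hx, hxσ⟩, hσ, h2⟩)
      rw [le_div_iff₀ (neg_pos.2 h2)] at this
      simp only at this
      linarith
  have hne0 : ∀ a ∈ simplexPointPairs S, insert a.2 a.1 ≠ insert x₀ σ₀ → gap a.1 a.2 w' ≠ 0 := by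
    intro a ha hins h0
    refine hgen a ha (σ₀, x₀) hpair hins ?_
    rw [hgap'] at h0
    simp only
    linear_combination gap σ₀ x₀ paraboloid * h0 - gap a.1 a.2 paraboloid * hueq
  have hσ₀s := hS.isSimplex hσ₀S hσ₀c
  have hcrit : IsCritical S (insert x₀ σ₀) w' := by
    refine ⟨Finset.insert_subset hx₀ hσ₀S, by rw [Finset.card_insert_of_notMem hx₀σ, hσ₀c],
      ⟨interp σ₀ w', ?_, ?_⟩, hne0⟩
    · intro x hx
      rcases Finset.mem_insert.1 hx with rfl | hx
      · rw [gap] at hzero; linarith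
      · exact hσ₀s.interp_of_mem w' hx
    · intro x hx hxZ
      have hxσ : x ∉ σ₀ := fun h => hxZ (Finset.mem_insert_of_mem h)
      have h1 := hne0 (σ₀, x) (mem_simplexPointPairs.2 ⟨⟨hσ₀S, hσ₀c⟩, hx, hxσ⟩)
        (fun h => hxZ (h ▸ Finset.mem_insert_self x σ₀))
      have := lt_of_le_of_ne (hnonneg σ₀ hσ₀t x hx hxσ) (Ne.symm h1)
      rw [gap] at this
      linarith
  obtain ⟨ε, hε, hεs⟩ := exists_small S w' paraboloid
  have hpos : IsSmallFor S w' ε := isSmallFor_of_abs (fun a ha h0 => by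
    rw [abs_of_pos hε]; exact hεs a ha h0)
  have hneg : IsSmallFor S w' (-ε) := isSmallFor_of_abs (fun a ha h0 => by
    rw [abs_neg, abs_of_pos hε]; exact hεs a ha h0)
  have hteq : t = lowerCells S (w' + (-ε) • paraboloid) := by
    refine eq_lowerCells_of_subset hS ht.1 fun σ hσ => mem_lowerCells.2
      ⟨ht.1.subset σ hσ, ht.1.card_eq σ hσ, fun x hx hxσ => ?_⟩
    have h0 := hnonneg σ hσ x hx hxσ
    rcases h0.eq_or_lt with h0 | h0
    · -- here the gap vanishes at the critical moment, so it is decreasing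
      have h1 := hwpos σ hσ x hx hxσ
      rw [hgap'] at h0
      have h2 : gap σ x paraboloid < 0 := by
        by_contra hcon
        have := mul_nonneg hu0.le (not_lt.1 hcon)
        linarith
      rw [gap_add_smul, hgap', ← h0, zero_add, neg_mul, neg_pos]
      exact mul_neg_of_pos_of_neg hε h2
    · exact (hneg (σ, x) (mem_simplexPointPairs.2
        ⟨⟨ht.1.subset σ hσ, ht.1.card_eq σ hσ⟩, hx, hxσ⟩) h0.ne').1.2 h0
  obtain ⟨hflip, hlt⟩ := hcrit.isFlip hS hε hpos hneg
  rw [← hteq] at hflip hlt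
  exact ⟨_, ⟨isTriangulation_lowerCells hS (hσ₀c ▸ Finset.card_le_card hσ₀S)
    (hcrit.isGeneric hS hε.ne' hpos), isRegular_lowerCells hS _⟩, hflip, hlt⟩

end ParabolicFlips

theorem theorem4 {d : ℕ} (S : Finset (EuclideanSpace ℝ (Fin d)))
    (hS : ParabolicFlips.GeneralPosition S)
    (t : Finset (Finset (EuclideanSpace ℝ (Fin d))))
    (ht : ParabolicFlips.IsRegularTriangulation S t) :
    ∃ (m : ℕ) (T : ℕ → Finset (Finset (EuclideanSpace ℝ (Fin d)))),
      T 0 = t ∧ T m = ParabolicFlips.delaunay S ∧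
      (∀ i ≤ m, ParabolicFlips.IsRegularTriangulation S (T i)) ∧
      (∀ i < m, ParabolicFlips.IsFlip S (T i) (T (i + 1)) ∧
        ParabolicFlips.Vr (T (i + 1)) < ParabolicFlips.Vr (T i)) := by
  -- induction on the number of sets of cells with a smaller value of the functional
  induction hn : (S.powerset.powerset.filter fun s =>
      ParabolicFlips.Vr s < ParabolicFlips.Vr t).card using Nat.strong_induction_on
      generalizing t with
  | _ n ih =>
    by_cases hne : t = ParabolicFlips.delaunay S
    · exact ⟨0, fun _ => t, rfl, hne, fun _ _ => ht, fun i hi => absurd hi (Nat.not_lt_zero i)⟩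
    obtain ⟨t', ht', hflip, hlt⟩ := ParabolicFlips.exists_flip hS ht hne
    have hmem : t' ∈ S.powerset.powerset := Finset.mem_powerset.2 fun σ hσ =>
      Finset.mem_powerset.2 (ht'.1.subset σ hσ)
    obtain ⟨m, T, hT0, hTm, hreg, hstep⟩ := ih _ (by
      rw [← hn]
      refine Finset.card_lt_card ⟨fun s hs => ?_, fun hsub => ?_⟩
      · obtain ⟨h1, h2⟩ := Finset.mem_filter.1 hs
        exact Finset.mem_filter.2 ⟨h1, h2.trans hlt⟩
      · exact lt_irrefl _
          (Finset.mem_filter.1 (hsub (Finset.mem_filter.2 ⟨hmem, hlt⟩))).2) t' ht' rfl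
    refine ⟨m + 1, fun i => Nat.casesOn i t T, rfl, hTm, ?_, ?_⟩
    · rintro (_ | i) hi
      · exact ht
      · exact hreg i (Nat.le_of_succ_le_succ hi)
    · rintro (_ | i) hi
      · simpa only [hT0] using ⟨hflip, hlt⟩
      · exact hstep i (Nat.lt_of_succ_lt_succ hi)
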